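/- Let $G=SL(2,\mathbf R)$ act on the hyperbolic plane $H^2$ and on its boundary circle $S^1$ (Poincaré disc model), and let $T\to S^1$ be the complexified tangent bundle with its complex powers $T^s$, trivialized by powers of the rotational vector field $\partial$; thus $g\in G$ acts on sections $\varphi\,\partial^s$ of $T^s$ by $(g\varphi)(z)=((g^{-1})'(z))^{-s}\varphi(g^{-1}z)$, the derivative being taken with respect to the angle. For $\lambda\in\mathbf C$ let $H^\lambda_{-\omega}$ be the space of hyperfunction sections of $T^{\lambda-1/2}$, i.e. of continuous linear functionals on $C^\omega(S^1,T^{-\lambda-1/2})$, with the dual action of $G$. Let $\Gamma\subset G$ be a discrete subgroup which acts freely on $H^2$ and is convex co-compact (it acts co-compactly on some non-empty closed geodesically convex $\Gamma$-invariant subset of $H^2$). Let $\Lambda\subset S^1$ be its limit set, i.e. the set of accumulation points in $S^1$ of an orbit of $\Gamma$ in the disc, and let $H^\lambda_{-\omega,\Lambda}\subset H^\lambda_{-\omega}$ be the $\Gamma$-submodule of the hyperfunctions with support in $\Lambda$. If $\Gamma$ is non-trivial and abelian, then $\Lambda$ consists of two points, and for every odd natural number $k$ $$\dim H^0(\Gamma,H^{-k/2}_{-\omega,\Lambda})=\dim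 H^1(\Gamma,H^{-k/2}_{-\omega,\Lambda})=2 .$$ Moreover, the classes are represented by derivatives of delta distributions located at $\Lambda$: every element of $H^0(\Gamma,H^{-k/2}_{-\omega,\Lambda})$ is a finite linear combination of derivatives of delta distributions at the points of $\Lambda$, and every class in $H^1(\Gamma,H^{-k/2}_{-\omega,\Lambda})$ is represented by a 1-cocycle all of whose values are such finite linear combinations. -/

import Mathlib

open scoped MatrixGroups UpperHalfPlane Topology

noncomputable section

namespace FuchsianHyperfunction

/-! ### The action of `SL(2, ℝ)` on the Poincaré disc and on its boundary circle -/

/-- The Cayley transform `z ↦ (z - i) / (z + i)` from the upper half plane to the unit disc. -/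
def cayley (z : ℍ) : ℂ := ((z : ℂ) - Complex.I) / ((z : ℂ) + Complex.I)

/-- The conjugate of `g ∈ SL(2, ℝ)` by the Cayley transform is the element
`(α β; conj β conj α)` of `SU(1, 1)`; this is its entry `α`. -/
def suA (g : SL(2, ℝ)) : ℂ := ⟨(g 0 0 + g 1 1) / 2, (g 0 1 - g 1 0) / 2⟩

/-- The entry `β` of the element `(α β; conj β conj α)` of `SU(1, 1)` corresponding to `g`. -/
def suB (g : SL(2, ℝ)) : ℂ := ⟨(g 0 0 - g 1 1) / 2, -(g 0 1 + g 1 0) / 2⟩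

/-- The denominator `conj β * z + conj α` of the Möbius transformation of the disc given by `g`. -/
def den (g : SL(2, ℝ)) (z : ℂ) : ℂ := star (suB g) * z + star (suA g)

/-- The Möbius transformation of the closed unit disc given by `g`. -/
def mob (g : SL(2, ℝ)) (z : ℂ) : ℂ := (suA g * z + suB g) / den g z

lemma suA_one : suA 1 = 1 := by
  apply Complex.ext <;> simp [suA]

lemma suB_one : suB 1 = 0 := by
  apply Complex.ext <;> simp [suB]

lemma suA_mul (g h : SL(2, ℝ)) :
    suA (g * h) = suA g * suA h + suB g * star (suB h) := by
  apply Complex.ext <;>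
    simp [suA, suB, Matrix.SpecialLinearGroup.coe_mul, Matrix.mul_apply, Fin.sum_univ_two] <;> ring

lemma suB_mul (g h : SL(2, ℝ)) :
    suB (g * h) = suA g * suB h + suB g * star (suA h) := by
  apply Complex.ext <;>
    simp [suA, suB, Matrix.SpecialLinearGroup.coe_mul, Matrix.mul_apply, Fin.sum_univ_two] <;> ring

lemma su_det (g : SL(2, ℝ)) : suA g * star (suA g) - suB g * star (suB g) = 1 := by
  have h := g.det_coe
  rw [Matrix.det_fin_two] at h
  apply Complex.ext
  · simp [suA, suB]
    linear_combination h
  · simp [suA, suB]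
    ring

lemma su_normSq (g : SL(2, ℝ)) : ‖suA g‖ ^ 2 - ‖suB g‖ ^ 2 = 1 := by
  have h := su_det g
  have h1 : ∀ w : ℂ, w * star w = ((‖w‖ ^ 2 : ℝ) : ℂ) := fun w => by
    simpa using Complex.mul_conj' w
  rw [h1, h1] at h
  exact_mod_cast h

lemma den_ne_zero (g : SL(2, ℝ)) {z : ℂ} (hz : ‖z‖ ≤ 1) : den g z ≠ 0 := by
  intro h
  have h1 : star (suA g) = -(star (suB g) * z) := by
    unfold den at h; linear_combination h
  have h2 : ‖suA g‖ = ‖suB g‖ * ‖z‖ := by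
    have := congrArg norm h1
    simpa using this
  have h3 := su_normSq g
  nlinarith [norm_nonneg (suA g), norm_nonneg (suB g), norm_nonneg z,
    mul_le_mul_of_nonneg_left hz (norm_nonneg (suB g))]

lemma norm_num_eq (g : SL(2, ℝ)) {z : ℂ} (hz : ‖z‖ = 1) :
    suA g * z + suB g = z * star (den g z) := by
  have h1 : z * star z = 1 := by
    have := Complex.mul_conj' z
    simpa [hz] using this
  simp only [den, star_add, star_mul', star_star]
  linear_combination (-(suB g)) * h1

lemma norm_mob (g : SL(2, ℝ)) {z : ℂ} (hz : ‖z‖ = 1) : ‖mob g z‖ = 1 := by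
  have h := den_ne_zero g hz.le
  rw [mob, norm_num_eq g hz, norm_div, norm_mul, norm_star, hz, one_mul,
    div_self (norm_ne_zero_iff.2 h)]

lemma den_mul (g h : SL(2, ℝ)) {z : ℂ} (hz : ‖z‖ ≤ 1) :
    den (g * h) z = den g (mob h z) * den h z := by
  have h0 := den_ne_zero h hz
  have : mob h z * den h z = suA h * z + suB h := by
    rw [mob, div_mul_cancel₀ _ h0]
  calc den (g * h) z = star (suB g) * (suA h * z + suB h) + star (suA g) * den h z := by
        simp only [den, suA_mul, suB_mul, star_add, star_mul', star_star]; ring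
    _ = den g (mob h z) * den h z := by rw [← this]; simp only [den]; ring

lemma mob_mul (g h : SL(2, ℝ)) {z : ℂ} (hz : ‖z‖ = 1) :
    mob (g * h) z = mob g (mob h z) := by
  have h0 := den_ne_zero h hz.le
  have h1 := den_ne_zero g (norm_mob h hz).le
  have : mob h z * den h z = suA h * z + suB h := by
    rw [mob, div_mul_cancel₀ _ h0]
  have h2 : suA (g * h) * z + suB (g * h) = (suA g * mob h z + suB g) * den h z := by
    calc _ = suA g * (suA h * z + suB h) + suB g * den h z := by
          simp only [den, suA_mul, suB_mul]; ring
      _ = _ := by rw [← this]; ring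
  rw [mob, den_mul g h hz.le, h2, mul_div_mul_right _ _ h0]
  rfl

/-- The Cayley transform intertwines the actions on the half plane and on the disc. -/
lemma cayley_smul (g : SL(2, ℝ)) (z : ℍ) : cayley (g • z) = mob g (cayley z) := by
  have hI : ∀ w : ℍ, (w : ℂ) + Complex.I ≠ 0 := fun w h => by
    have := congrArg Complex.im h
    simp at this
    linarith [w.im_pos]
  have hd : ((g 1 0 : ℝ) : ℂ) * z + ((g 1 1 : ℝ) : ℂ) ≠ 0 := by
    have := UpperHalfPlane.denom_ne_zero (g : GL (Fin 2) ℝ) z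
    simpa [UpperHalfPlane.denom] using this
  have hg := hI (g • z)
  have hz := hI z
  have hA : suA g = (((g 0 0 : ℝ) : ℂ) + (g 1 1 : ℝ)) / 2
      + ((g 0 1 : ℝ) - (g 1 0 : ℝ)) / 2 * Complex.I := by
    apply Complex.ext <;> simp [suA]
  have hB : suB g = (((g 0 0 : ℝ) : ℂ) - (g 1 1 : ℝ)) / 2
      - ((g 0 1 : ℝ) + (g 1 0 : ℝ)) / 2 * Complex.I := by
    apply Complex.ext <;> simp [suB]
    ring
  have hA' : star (suA g) = (((g 0 0 : ℝ) : ℂ) + (g 1 1 : ℝ)) / 2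
      - ((g 0 1 : ℝ) - (g 1 0 : ℝ)) / 2 * Complex.I := by
    apply Complex.ext <;> simp [suA]
  have hB' : star (suB g) = (((g 0 0 : ℝ) : ℂ) - (g 1 1 : ℝ)) / 2
      + ((g 0 1 : ℝ) + (g 1 0 : ℝ)) / 2 * Complex.I := by
    apply Complex.ext <;> simp [suB]
    ring
  have hs : ((g • z : ℍ) : ℂ) = (((g 0 0 : ℝ) : ℂ) * z + ((g 0 1 : ℝ) : ℂ)) /
      (((g 1 0 : ℝ) : ℂ) * z + ((g 1 1 : ℝ) : ℂ)) := by
    have := UpperHalfPlane.coe_specialLinearGroup_apply g z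
    simpa using this
  rw [hs] at hg
  have hnum : suA g * ((z : ℂ) - Complex.I) + suB g * ((z : ℂ) + Complex.I)
      = (((g 0 0 : ℝ) : ℂ) * z + (g 0 1 : ℝ)) -
        Complex.I * (((g 1 0 : ℝ) : ℂ) * z + (g 1 1 : ℝ)) := by
    rw [hA, hB]
    linear_combination (-(((g 0 1 : ℝ) : ℂ))) * Complex.I_mul_I
  have hden : star (suB g) * ((z : ℂ) - Complex.I) + star (suA g) * ((z : ℂ) + Complex.I)
      = (((g 0 0 : ℝ) : ℂ) * z + (g 0 1 : ℝ)) +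
        Complex.I * (((g 1 0 : ℝ) : ℂ) * z + (g 1 1 : ℝ)) := by
    rw [hA', hB']
    linear_combination (-(((g 0 1 : ℝ) : ℂ))) * Complex.I_mul_I
  have e1 : mob g (cayley z) =
      (suA g * ((z : ℂ) - Complex.I) + suB g * ((z : ℂ) + Complex.I)) /
      (star (suB g) * ((z : ℂ) - Complex.I) + star (suA g) * ((z : ℂ) + Complex.I)) := by
    rw [mob, den, cayley, ← mul_div_mul_right _ _ hz]
    congr 1 <;> field_simp
  rw [e1, hnum, hden, cayley, hs, ← mul_div_mul_right _ _ hd, sub_mul, add_mul,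
    div_mul_cancel₀ _ hd]

lemma norm_cayley_lt (z : ℍ) : ‖cayley z‖ < 1 := by
  have hz : 0 < ‖(z : ℂ) + Complex.I‖ := by
    rw [norm_pos_iff]
    intro h
    have := congrArg Complex.im h
    simp at this
    linarith [z.im_pos]
  rw [cayley, norm_div, div_lt_one hz, ← sq_lt_sq₀ (norm_nonneg _) (norm_nonneg _),
    ← Complex.normSq_eq_norm_sq, ← Complex.normSq_eq_norm_sq, Complex.normSq_apply,
    Complex.normSq_apply]
  simp
  nlinarith [z.im_pos]

/-- The action of `g ∈ SL(2, ℝ)` on the boundary circle of the Poincaré disc. -/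
def circleAct (g : SL(2, ℝ)) (z : Circle) : Circle :=
  ⟨mob g z, mem_sphere_zero_iff_norm.2 (norm_mob g (Circle.norm_coe z))⟩

@[simp] lemma coe_circleAct (g : SL(2, ℝ)) (z : Circle) :
    (circleAct g z : ℂ) = mob g z := rfl

lemma circleAct_mul (g h : SL(2, ℝ)) (z : Circle) :
    circleAct (g * h) z = circleAct g (circleAct h z) :=
  Circle.ext (mob_mul g h (Circle.norm_coe z))

lemma circleAct_one (z : Circle) : circleAct 1 z = z := by
  apply Circle.ext
  simp [mob, den, suA_one, suB_one]

/-- The derivative of the diffeomorphism `z ↦ g z` of the circle with respect to the angle: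
`g` maps the rotational vector field `∂` at `z` to `angDeriv g z • ∂` at `g z`.
(For `w = mob g z` one has `dw / dz = (den g z)⁻²` and `|dw / dz|` is the angular derivative.) -/
def angDeriv (g : SL(2, ℝ)) (z : Circle) : ℝ := (‖den g z‖ ^ 2)⁻¹

lemma angDeriv_pos (g : SL(2, ℝ)) (z : Circle) : 0 < angDeriv g z := by
  have := norm_pos_iff.2 (den_ne_zero g (Circle.norm_coe z).le)
  unfold angDeriv
  positivity

lemma angDeriv_mul (g h : SL(2, ℝ)) (z : Circle) :
    angDeriv (g * h) z = angDeriv g (circleAct h z) * angDeriv h z := by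
  simp only [angDeriv, den_mul g h (Circle.norm_coe z).le, coe_circleAct, norm_mul, mul_pow,
    mul_inv]

lemma angDeriv_one (z : Circle) : angDeriv 1 z = 1 := by
  simp [angDeriv, den, suA_one, suB_one]

/-- The chain rule that identifies `angDeriv` with the angular derivative. -/
lemma hasDerivAt_mob (g : SL(2, ℝ)) {z : ℂ} (hz : ‖z‖ ≤ 1) :
    HasDerivAt (mob g) ((den g z ^ 2)⁻¹) z := by
  have h0 := den_ne_zero g hz
  have h1 : HasDerivAt (fun z => suA g * z + suB g) (suA g) z := by
    simpa using ((hasDerivAt_id z).const_mul (suA g)).add_const (suB g)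
  have h2 : HasDerivAt (den g) (star (suB g)) z := by
    have := ((hasDerivAt_id z).const_mul (star (suB g))).add_const (star (suA g))
    rwa [mul_one] at this
  have h3 := h1.div h2 h0
  have h4 : suA g * den g z - (suA g * z + suB g) * star (suB g) = 1 := by
    rw [← su_det g]; simp only [den]; ring
  rw [h4, one_div] at h3
  exact h3

/-! ### Real analytic sections and the principal series -/

/-- The space `C^ω(S¹)` of complex valued real analytic functions on the circle, i.e. of the
restrictions to the circle of functions that are holomorphic in a neighbourhood of it. -/
def Analytic : Submodule ℂ (Circle → ℂ) where
  carrier := {φ | ∃ F : ℂ → ℂ, AnalyticOnNhd ℂ F (Metric.sphere 0 1) ∧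
    ∀ z : Circle, F z = φ z}
  add_mem' := by
    rintro φ ψ ⟨F, hF, hF'⟩ ⟨G, hG, hG'⟩
    exact ⟨F + G, hF.add hG, fun z => by simp [hF', hG']⟩
  zero_mem' := ⟨0, fun z _ => analyticAt_const, fun z => rfl⟩
  smul_mem' := by
    rintro c φ ⟨F, hF, hF'⟩
    exact ⟨c • F, fun z hz => (hF z hz).const_smul, fun z => by simp [hF']⟩

/-- The holomorphic continuation of `z ↦ (angDeriv g z) ^ (-s)`. -/
def weightExt (s : ℂ) (g : SL(2, ℝ)) (z : ℂ) : ℂ :=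
  (den g z * (suB g * z⁻¹ + suA g)) ^ s

lemma den_mul_star (g : SL(2, ℝ)) {z : ℂ} (hz : ‖z‖ = 1) :
    den g z * (suB g * z⁻¹ + suA g) = ((‖den g z‖ ^ 2 : ℝ) : ℂ) := by
  have h1 : z⁻¹ = star z := by
    rw [Complex.inv_def, Complex.normSq_eq_norm_sq, hz]; simp
  have h2 : suB g * z⁻¹ + suA g = star (den g z) := by
    rw [h1]; simp [den]
  rw [h2]
  simpa using Complex.mul_conj' (den g z)

lemma weightExt_eq (s : ℂ) (g : SL(2, ℝ)) (z : Circle) :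
    weightExt s g z = (angDeriv g z : ℂ) ^ (-s) := by
  have hp := norm_pos_iff.2 (den_ne_zero g (Circle.norm_coe z).le)
  rw [weightExt, den_mul_star g (Circle.norm_coe z), angDeriv, Complex.cpow_neg,
    Complex.ofReal_inv, Complex.inv_cpow, inv_inv]
  rw [Complex.arg_ofReal_of_nonneg (by positivity)]
  exact Real.pi_pos.ne

lemma analyticAt_mob (g : SL(2, ℝ)) {z : ℂ} (hz : ‖z‖ ≤ 1) : AnalyticAt ℂ (mob g) z := by
  have h0 := den_ne_zero g hz
  unfold mob
  refine AnalyticAt.div (by fun_prop) ?_ h0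
  unfold den
  fun_prop

lemma analyticAt_weightExt (s : ℂ) (g : SL(2, ℝ)) {z : ℂ} (hz : ‖z‖ = 1) :
    AnalyticAt ℂ (weightExt s g) z := by
  have hz0 : z ≠ 0 := by rintro rfl; simp at hz
  have h0 := norm_pos_iff.2 (den_ne_zero g hz.le)
  unfold weightExt
  refine AnalyticAt.cpow ?_ analyticAt_const ?_
  · refine AnalyticAt.mul (by unfold den; fun_prop) ?_
    exact (analyticAt_const.mul (analyticAt_id.inv hz0)).add analyticAt_const
  · rw [den_mul_star g hz, Complex.ofReal_mem_slitPlane]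
    positivity

/-- If `F` extends `φ`, then `weightExt s g⁻¹ * F ∘ mob g⁻¹` extends `g φ`. -/
lemma analyticAt_transform (s : ℂ) (g : SL(2, ℝ)) (F : ℂ → ℂ) {z : ℂ} (hz : ‖z‖ = 1)
    (hF : AnalyticAt ℂ F (mob g z)) :
    AnalyticAt ℂ (fun w => weightExt s g w * F (mob g w)) z :=
  (analyticAt_weightExt s g hz).mul (hF.comp (analyticAt_mob g hz.le))

/-- The natural action of `SL(2, ℝ)` on `C^ω(S¹, T^s)`, where `T` is the complexified tangent
bundle of the circle and the section `φ ∂^s` is identified with the function `φ`: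
`(g φ)(z) = ((g⁻¹)'(z))^(-s) φ(g⁻¹ z)`. -/
def sectionRep (s : ℂ) : Representation ℂ SL(2, ℝ) Analytic where
  toFun g :=
    { toFun := fun φ => ⟨fun z => (angDeriv g⁻¹ z : ℂ) ^ (-s) * φ.1 (circleAct g⁻¹ z), by
        obtain ⟨φ, F, hF, hF'⟩ := φ
        refine ⟨fun w => weightExt s g⁻¹ w * F (mob g⁻¹ w), fun z hz => ?_, fun z => ?_⟩
        · have hz' : ‖z‖ = 1 := by simpa using hz
          exact analyticAt_transform s g⁻¹ F hz' (hF _ (by simpa using norm_mob g⁻¹ hz'))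
        · simp only [weightExt_eq]
          rw [← coe_circleAct, hF']⟩
      map_add' := fun φ ψ => by
        ext z
        simp [mul_add]
      map_smul' := fun c φ => by
        ext z
        simp [mul_left_comm] }
  map_one' := by
    ext φ z
    simp [angDeriv_one, circleAct_one]
  map_mul' g h := by
    ext φ z
    simp only [Module.End.mul_apply, LinearMap.coe_mk, AddHom.coe_mk, mul_inv_rev]
    rw [circleAct_mul, angDeriv_mul, Complex.ofReal_mul,
      Complex.mul_cpow_ofReal_nonneg (angDeriv_pos _ _).le (angDeriv_pos _ _).le]
    ring

lemma sectionRep_apply (s : ℂ) (g : SL(2, ℝ)) (φ : Analytic) (z : Circle) :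
    (sectionRep s g φ).1 z = (angDeriv g⁻¹ z : ℂ) ^ (-s) * φ.1 (circleAct g⁻¹ z) := rfl

/-! ### Hyperfunctions -/

/-- Analytic functionals carried by a set `K` of points of the circle: linear functionals `L` on
`C^ω(S¹)` such that for every open neighbourhood `U` of `K` in `ℂ` there is `C` with
`|L φ| ≤ C sup_U |F|` whenever `F` is holomorphic on `U` and near the circle, and extends `φ`.
For `K` the whole circle, `carried K` consists of the functionals that are continuous for the
usual (inductive limit) topology of `C^ω(S¹)`, i.e. of the hyperfunctions on the circle; for a
closed set `K`, it consists of the hyperfunctions with support in `K`. -/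
def carried (K : Set Circle) : Submodule ℂ (Module.Dual ℂ Analytic) where
  carrier := {L | ∀ U : Set ℂ, IsOpen U → (∀ p ∈ K, (p : ℂ) ∈ U) → ∃ C : ℝ,
    ∀ (φ : Analytic) (F : ℂ → ℂ), AnalyticOnNhd ℂ F (U ∪ Metric.sphere 0 1) →
      (∀ z : Circle, F z = φ.1 z) → ∀ M : ℝ, 0 ≤ M → (∀ z ∈ U, ‖F z‖ ≤ M) → ‖L φ‖ ≤ C * M}
  add_mem' := by
    intro L L' hL hL' U hU hK
    obtain ⟨C, hC⟩ := hL U hU hK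
    obtain ⟨C', hC'⟩ := hL' U hU hK
    refine ⟨C + C', fun φ F hF hφ M hM hFM => ?_⟩
    rw [LinearMap.add_apply, add_mul]
    exact (norm_add_le _ _).trans (add_le_add (hC φ F hF hφ M hM hFM) (hC' φ F hF hφ M hM hFM))
  zero_mem' := fun U _ _ => ⟨0, fun φ F _ _ M _ _ => by simp⟩
  smul_mem' := by
    intro c L hL U hU hK
    obtain ⟨C, hC⟩ := hL U hU hK
    refine ⟨‖c‖ * C, fun φ F hF hφ M hM hFM => ?_⟩
    rw [LinearMap.smul_apply, norm_smul, mul_assoc]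
    exact mul_le_mul_of_nonneg_left (hC φ F hF hφ M hM hFM) (norm_nonneg c)

/-- Hyperfunctions carried by `K` are mapped by `g` to hyperfunctions carried by `K'` if
`g` maps `K` into `K'`. -/
lemma dual_mem_carried (s : ℂ) (g : SL(2, ℝ)) {K K' : Set Circle}
    (hK : ∀ p ∈ K, circleAct g p ∈ K') {L : Module.Dual ℂ Analytic} (hL : L ∈ carried K) :
    (sectionRep s).dual g L ∈ carried K' := by
  intro U hU hUK
  obtain ⟨B, hB⟩ := (isCompact_sphere (0 : ℂ) 1).exists_bound_of_continuousOn
    (f := weightExt s g) (fun z hz =>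
      (analyticAt_weightExt s g (by simpa using hz)).continuousAt.continuousWithinAt)
  have hB0 : 0 ≤ B := (norm_nonneg _).trans (hB 1 (by simp))
  let P : ℂ → Prop := fun y => mob g y ∈ U ∧ AnalyticAt ℂ (mob g) y ∧
    AnalyticAt ℂ (weightExt s g) y ∧ ‖weightExt s g y‖ < B + 1
  obtain ⟨C, hC⟩ := hL {z | ∀ᶠ y in 𝓝 z, P y} isOpen_setOfPred_eventually_nhds (fun p hp => by
    have hp1 : ‖(p : ℂ)‖ = 1 := Circle.norm_coe p
    have hm := analyticAt_mob g hp1.le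
    have hw := analyticAt_weightExt s g hp1
    have h1 : ∀ᶠ y in 𝓝 (p : ℂ), mob g y ∈ U :=
      hm.continuousAt.eventually (hU.mem_nhds (hUK _ (hK p hp)))
    have h2 : ∀ᶠ y in 𝓝 (p : ℂ), ‖weightExt s g y‖ < B + 1 :=
      hw.continuousAt.norm.eventually (gt_mem_nhds (by
        have := hB p (mem_sphere_zero_iff_norm.2 hp1)
        linarith))
    filter_upwards [h1, h2, hm.eventually_analyticAt, hw.eventually_analyticAt]
      with y a b c d using ⟨a, c, d, b⟩)
  refine ⟨C * (B + 1), fun φ F hF hφ M hM hFM => ?_⟩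
  rw [mul_assoc, Representation.dual_apply]
  refine hC (sectionRep s g⁻¹ φ) (fun w => weightExt s g w * F (mob g w)) ?_ ?_ _
    (by positivity) ?_
  · rintro z (hz | hz)
    · obtain ⟨h1, h2, h3, -⟩ := hz.self_of_nhds
      exact h3.mul ((hF _ (Or.inl h1)).comp h2)
    · have hz' : ‖z‖ = 1 := by simpa using hz
      exact analyticAt_transform s g F hz' (hF _ (Or.inr (by simpa using norm_mob g hz')))
  · intro z
    simp only [sectionRep_apply, inv_inv, weightExt_eq]
    rw [← coe_circleAct, hφ]
  · intro z hz
    obtain ⟨h1, -, -, h4⟩ := hz.self_of_nhds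
    rw [norm_mul]
    exact mul_le_mul h4.le (hFM _ h1) (norm_nonneg _) (by positivity)

/-! ### Fuchsian groups and their limit sets -/

/-- The limit set of `Γ`: the boundary points of the disc that are accumulation points, in the
Euclidean topology, of an orbit of `Γ` in the disc. (For discrete groups all orbits have the same
accumulation points, and these lie on the boundary.) -/
def limitSet (Γ : Subgroup SL(2, ℝ)) : Set Circle :=
  {p | ∃ x : ℍ, AccPt (p : ℂ) (Filter.principal {w | ∃ γ ∈ Γ, w = cayley (γ • x)})}

lemma mob_injOn (g : SL(2, ℝ)) {z w : ℂ} (hz : ‖z‖ ≤ 1) (hw : ‖w‖ ≤ 1)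
    (h : mob g z = mob g w) : z = w := by
  rw [mob, mob, div_eq_div_iff (den_ne_zero g hz) (den_ne_zero g hw)] at h
  simp only [den] at h
  linear_combination h - (z - w) * su_det g

lemma circleAct_mem_limitSet (Γ : Subgroup SL(2, ℝ)) {g : SL(2, ℝ)} (hg : g ∈ Γ) {p : Circle}
    (hp : p ∈ limitSet Γ) : circleAct g p ∈ limitSet Γ := by
  obtain ⟨x, hx⟩ := hp
  refine ⟨x, ?_⟩
  rw [accPt_iff_frequently] at hx ⊢
  have hp1 : ‖(p : ℂ)‖ = 1 := Circle.norm_coe p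
  refine (analyticAt_mob g hp1.le).continuousAt.frequently (hx.mono ?_)
  rintro y ⟨hy, γ, hγ, rfl⟩
  refine ⟨fun h => hy (mob_injOn g (norm_cayley_lt _).le hp1.le h), g * γ, Γ.mul_mem hg hγ, ?_⟩
  rw [mul_smul, cayley_smul g]

/-- `Γ` acts freely on the hyperbolic plane. -/
def ActsFreely (Γ : Subgroup SL(2, ℝ)) : Prop :=
  ∀ γ ∈ Γ, ∀ z : ℍ, γ • z = z → γ = 1

/-- A subset of the hyperbolic plane is geodesically convex if with any two points it contains
the geodesic segment between them. -/
def GeodesicallyConvex (C : Set ℍ) : Prop :=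
  ∀ x ∈ C, ∀ y ∈ C, ∀ z : ℍ, dist x z + dist z y = dist x y → z ∈ C

/-- `Γ` is convex co-compact: it acts co-compactly on some non-empty closed convex invariant
subset of the hyperbolic plane. -/
def ConvexCocompact (Γ : Subgroup SL(2, ℝ)) : Prop :=
  ∃ C : Set ℍ, C.Nonempty ∧ IsClosed C ∧ GeodesicallyConvex C ∧
    (∀ γ ∈ Γ, ∀ z ∈ C, γ • z ∈ C) ∧
    ∃ K : Set ℍ, IsCompact K ∧ ∀ z ∈ C, ∃ γ ∈ Γ, γ • z ∈ K

/-! ### The `Γ`-modules -/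

/-- The hyperfunction vectors `H^l_{-ω}` of the principal series: hyperfunction sections
of `T^(l - 1/2)`, realized as the continuous functionals on `C^ω(S¹, T^(-l - 1/2))` with the dual
of the natural action. This is the action on all linear functionals. -/
def functionalRep (l : ℂ) : Representation ℂ SL(2, ℝ) (Module.Dual ℂ Analytic) :=
  (sectionRep (-l - 1 / 2)).dual

/-- The `Γ`-module `H^l_{-ω,Λ}` of the hyperfunction sections of `T^(l - 1/2)` with support in
the limit set of `Γ`. -/
def hyperfunctionModule (Γ : Subgroup SL(2, ℝ)) (l : ℂ) : Rep ℂ Γ :=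
  Rep.of (Representation.subrepresentation ((functionalRep l).comp Γ.subtype)
    (carried (limitSet Γ)) (fun g _ hL =>
      dual_mem_carried _ g.1 (fun _ hp => circleAct_mem_limitSet Γ g.2 hp) hL))

/-- An element of `H^l_{-ω,Λ}` as a functional on `C^ω(S¹)`. -/
def toFunctional (Γ : Subgroup SL(2, ℝ)) (l : ℂ) (f : hyperfunctionModule Γ l) :
    Module.Dual ℂ Analytic :=
  (carried (limitSet Γ)).subtype f

/-- Real analytic functions on the circle are smooth functions of the angle. -/
lemma contDiff_angle (φ : Analytic) (p : Circle) (n : ℕ) :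
    ContDiff ℝ n (fun t : ℝ => φ.1 (p * Circle.exp t)) := by
  obtain ⟨φ, F, hF, hφ⟩ := φ
  have : (fun t : ℝ => φ (p * Circle.exp t)) =
      fun t : ℝ => F ((p : ℂ) * Complex.exp (t * Complex.I)) := by
    funext t
    rw [← hφ]
    simp
  change ContDiff ℝ n (fun t : ℝ => φ (p * Circle.exp t))
  rw [this, contDiff_iff_contDiffAt]
  intro t
  have h1 : AnalyticAt ℝ F ((p : ℂ) * Complex.exp (t * Complex.I)) :=
    (hF _ (mem_sphere_zero_iff_norm.2 (by
      rw [norm_mul, Circle.norm_coe, Complex.norm_exp_ofReal_mul_I, one_mul]))).restrictScalars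
  have h2 : ContDiff ℝ n (fun t : ℝ => (p : ℂ) * Complex.exp (t * Complex.I)) := by
    have : ContDiff ℝ n (fun t : ℝ => (t : ℂ)) := Complex.ofRealCLM.contDiff
    fun_prop
  exact (h1.contDiffAt (n := n)).comp t h2.contDiffAt

/-- The `n`-th derivative (with respect to the angle) of the delta distribution at `p`. -/
def deltaDeriv (p : Circle) (n : ℕ) : Module.Dual ℂ Analytic where
  toFun φ := (-1) ^ n * iteratedDeriv n (fun t : ℝ => φ.1 (p * Circle.exp t)) 0
  map_add' φ ψ := by
    rw [← mul_add, ← iteratedDeriv_fun_add (contDiff_angle φ p n).contDiffAt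
      (contDiff_angle ψ p n).contDiffAt]
    rfl
  map_smul' c φ := by
    have := iteratedDeriv_const_smul_field (n := n) (x := (0 : ℝ)) c
      (fun t : ℝ => φ.1 (p * Circle.exp t))
    simp only [RingHom.id_apply, smul_eq_mul]
    rw [mul_left_comm]
    congr 1

/-- The span of the derivatives of delta distributions located at points of `K`. -/
def deltaSpan (K : Set Circle) : Submodule ℂ (Module.Dual ℂ Analytic) :=
  Submodule.span ℂ {L | ∃ p ∈ K, ∃ n : ℕ, L = deltaDeriv p n}

end FuchsianHyperfunction

end

open FuchsianHyperfunction

/-!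
The group `Γ` consists of `1` and of hyperbolic elements with a common axis: elliptic elements do
not act freely, and a parabolic element of an abelian group would have displacement bounded below
on the convex set with compact quotient, but arbitrarily small displacement at midpoints of an
orbit (`not_translation`). So `Γ` fixes two points `p` and `q` of the circle. A discrete group of
this kind is cyclic and has limit set `{p, q}` (`exists_axis`).

Put `k = 2 m + 1`. The module consists of functionals on the analytic sections of `T ^ m` that are
carried by `{p, q}`. Let `x` be a coordinate on the Riemann sphere that is real on the circle, with
`x = 0` at `p` and `x = ∞` at `q`, so that `γ` acts by `x ↦ κ x` for a positive number `κ`. The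
coordinate at `q` is `-1 / x`. A functional carried by `{p, q}` is determined by its moments, the
values on the germs `x ^ n` at `p` and `(-1 / x) ^ n` at `q`. These make sense because
`x ^ n / (1 + x ^ (2 N))` is analytic on the circle and tends, as `N` grows, to `x ^ n` near `p` and
to `0` near `q`. The sequences of moments that occur are those that decrease faster than every
geometric progression. Thus the module is the space of pairs of such sequences
(`pairFunctional_injective`, `range_pairFunctional`).

The germ `x ^ n ∂ₓ ^ m` is multiplied by a power of `κ` with exponent `± (n - m)`
(`coeffAt_sectionRep`), so that a generator `γ₀` acts diagonally. Its eigenvalues for `n ≠ m` stay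
away from `1`, hence `γ₀ - 1` is invertible on these terms, and kernel and cokernel of `γ₀ - 1` are
spanned by the moments of index `m` at the two points (`cohomology_of_diagonal`). For an infinite
cyclic group these are `H⁰` and `H¹`. The `m`-th Taylor coefficient at a point is a combination of
derivatives of the delta distribution there (`germFunctional_unitSeq_mem_deltaSpan`).
-/

noncomputable section

namespace FuchsianHyperfunction

/-! ### Cohomology of a cyclic group -/

section CyclicCohomology

open groupCohomology

variable {Γ : Type} [Group Γ] (A : Rep.{0} ℂ Γ)

/-- A `1`-cocycle on a cyclic group vanishes as soon as it vanishes on a generator. -/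
lemma cocycle_eq_zero_of_generator {γ₀ : Γ} (hgen : ∀ γ : Γ, ∃ n : ℤ, γ₀ ^ n = γ)
    (z : cocycles₁ A) (hz : z γ₀ = 0) : z = 0 := by
  have hmul := (mem_cocycles₁_iff (A := A) z).1 z.2
  have hinv : z γ₀⁻¹ = 0 := by
    have h := hmul γ₀⁻¹ γ₀
    simpa [hz] using h.symm
  apply cocycles₁_ext
  intro γ
  obtain ⟨n, rfl⟩ := hgen γ
  change z (γ₀ ^ n) = 0
  induction n with
  | zero => simp
  | succ n ih =>
    rw [zpow_add_one, hmul, hz, ih]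
    simp
  | pred n ih =>
    rw [zpow_sub_one, hmul, hinv, ih]
    simp

/-- The cocycle `γ ↦ ℓ γ • w` attached to an additive character `ℓ` and an invariant vector `w`. -/
def characterCocycle (ℓ : Γ → ℂ) (hℓ : ∀ g h, ℓ (g * h) = ℓ g + ℓ h) (W : Submodule ℂ A)
    (hW : ∀ γ : Γ, ∀ w ∈ W, A.ρ γ w = w) : W →ₗ[ℂ] cocycles₁ A where
  toFun w := ⟨fun γ => ℓ γ • (w : A), (mem_cocycles₁_iff _).2 fun g h => by
    rw [map_smul, hW g w w.2, hℓ, add_smul, add_comm]⟩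
  map_add' v w := by
    apply cocycles₁_ext
    intro γ
    exact smul_add _ _ _
  map_smul' c w := by
    apply cocycles₁_ext
    intro γ
    exact smul_comm _ _ _

/-- Cohomology in degrees `0` and `1` of an infinite cyclic group with generator `γ₀` whose module
is the direct sum of a space `W` of invariants and of the bijective image of `γ₀ - 1`: both are
isomorphic to `W`. -/
theorem cohomology_of_generator {γ₀ : Γ} (hgen : ∀ γ : Γ, ∃ n : ℤ, γ₀ ^ n = γ)
    (ℓ : Γ → ℂ) (hℓ : ∀ g h, ℓ (g * h) = ℓ g + ℓ h) (hℓ₀ : ℓ γ₀ ≠ 0) (W : Submodule ℂ A)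
    (hW : ∀ γ : Γ, ∀ w ∈ W, A.ρ γ w = w) (hker : ∀ a : A, A.ρ γ₀ a = a → a ∈ W)
    (hdisj : ∀ w ∈ W, ∀ a : A, A.ρ γ₀ a - a = w → w = 0)
    (hsum : ∀ a : A, ∃ w ∈ W, ∃ b : A, a = w + (A.ρ γ₀ b - b)) :
    Module.finrank ℂ (groupCohomology A 0) = Module.finrank ℂ W ∧
    Module.finrank ℂ (groupCohomology A 1) = Module.finrank ℂ W ∧
    (∀ c : groupCohomology A 0, ((H0Iso A).hom c).1 ∈ W) ∧
    (∀ c : groupCohomology A 1, ∃ z : cocycles₁ A, H1π A z = c ∧ ∀ γ : Γ, z γ ∈ W) := by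
  have hinv : A.ρ.invariants = W := by
    ext a
    exact ⟨fun h => hker a (h γ₀), fun h γ => hW γ a h⟩
  have hsurj : ∀ c : groupCohomology A 1, ∃ w : W,
      H1π A (characterCocycle A ℓ hℓ W hW w) = c := by
    intro c
    induction c using H1_induction_on with
    | h z =>
    obtain ⟨w, hw, b, hb⟩ := hsum (z γ₀)
    refine ⟨(ℓ γ₀)⁻¹ • ⟨w, hw⟩, ?_⟩
    rw [H1π_eq_iff]
    refine ⟨-b, ?_⟩
    have key : characterCocycle A ℓ hℓ W hW ((ℓ γ₀)⁻¹ • ⟨w, hw⟩) - z -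
        ⟨(d₀₁ A).hom (-b), d₀₁_apply_mem_cocycles₁ (-b)⟩ = 0 := by
      apply cocycle_eq_zero_of_generator A hgen
      change ℓ γ₀ • ((ℓ γ₀)⁻¹ • w) - z γ₀ - (A.ρ γ₀ (-b) - (-b)) = 0
      rw [hb, smul_inv_smul₀ hℓ₀, map_neg]
      abel
    have := congrArg Subtype.val (sub_eq_zero.1 key)
    exact this.symm
  refine ⟨?_, ?_, fun c => ?_, fun c => ?_⟩
  · rw [((H0Iso A).toLinearEquiv).finrank_eq]
    change Module.finrank ℂ A.ρ.invariants = _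
    rw [hinv]
  · refine (LinearEquiv.ofBijective
      ((H1π A).hom ∘ₗ characterCocycle A ℓ hℓ W hW) ⟨?_, hsurj⟩).finrank_eq.symm
    rw [← LinearMap.ker_eq_bot, LinearMap.ker_eq_bot']
    intro w hw
    obtain ⟨a, ha⟩ := (H1π_eq_zero_iff _).1 hw
    have h1 : A.ρ γ₀ a - a = ℓ γ₀ • (w : A) := congrFun ha γ₀
    have h2 := hdisj _ (W.smul_mem _ w.2) a h1
    exact Subtype.ext ((smul_eq_zero.1 h2).resolve_left hℓ₀)
  · exact hinv ▸ ((H0Iso A).hom c).2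
  · obtain ⟨w, hw⟩ := hsurj c
    exact ⟨_, hw, fun γ => W.smul_mem _ w.2⟩

end CyclicCohomology

/-! ### Elliptic and parabolic elements -/

section NoEllipticOrParabolic

/-- An element of `SL(2, ℝ)` with `|tr g| < 2` is elliptic. -/
lemma exists_fixed_of_trace_lt (g : SL(2, ℝ)) (h : (g 0 0 + g 1 1) ^ 2 < 4) :
    ∃ z : ℍ, g • z = z := by
  have hdet := g.det_coe
  rw [Matrix.det_fin_two] at hdet
  set a := g 0 0
  set b := g 0 1
  set c := g 1 0
  set d := g 1 1
  have hc : c ≠ 0 := by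
    intro hc
    rw [hc] at hdet
    nlinarith [sq_nonneg (a - d)]
  have hs : 0 < Real.sqrt (4 - (a + d) ^ 2) := Real.sqrt_pos.2 (by linarith)
  have hs2 := Real.sq_sqrt (show 0 ≤ 4 - (a + d) ^ 2 by linarith)
  set s := Real.sqrt (4 - (a + d) ^ 2)
  refine ⟨⟨⟨(a - d) / (2 * c), s / (2 * |c|)⟩, by positivity⟩, ?_⟩
  apply UpperHalfPlane.ext
  have hden := UpperHalfPlane.denom_ne_zero (g : GL (Fin 2) ℝ)
    ⟨⟨(a - d) / (2 * c), s / (2 * |c|)⟩, by positivity⟩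
  have hden' : ((c : ℝ) : ℂ) * (⟨(a - d) / (2 * c), s / (2 * |c|)⟩ : ℂ) + ((d : ℝ) : ℂ) ≠ 0 := by
    simpa [UpperHalfPlane.denom] using hden
  rw [UpperHalfPlane.coe_specialLinearGroup_apply]
  change (((a : ℝ) : ℂ) * (⟨(a - d) / (2 * c), s / (2 * |c|)⟩ : ℂ) + ((b : ℝ) : ℂ)) /
    (((c : ℝ) : ℂ) * (⟨(a - d) / (2 * c), s / (2 * |c|)⟩ : ℂ) + ((d : ℝ) : ℂ)) =
    (⟨(a - d) / (2 * c), s / (2 * |c|)⟩ : ℂ)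
  rw [div_eq_iff hden']
  have habs : |c| ≠ 0 := abs_ne_zero.2 hc
  have hcc : |c| ^ 2 = c ^ 2 := sq_abs c
  apply Complex.ext
  · simp
    have e1 : s / (2 * |c|) * (c * (s / (2 * |c|))) = s ^ 2 / (4 * c) := by
      rw [show s / (2 * |c|) * (c * (s / (2 * |c|))) = c * s ^ 2 / (4 * |c| ^ 2) by
        field_simp; ring, hcc]
      field_simp
    rw [e1, hs2]
    field_simp
    nlinarith
  · simp
    field_simp
    ring

/-- An element of `SL(2, ℝ)` with `|tr g| = 2` other than `±1` is conjugate to a translation. -/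
lemma exists_translation_of_trace_eq (g : SL(2, ℝ)) (h : (g 0 0 + g 1 1) ^ 2 = 4)
    (h1 : ∃ z : ℍ, g • z ≠ z) :
    ∃ (u : SL(2, ℝ)) (b : ℝ), b ≠ 0 ∧ ∀ z : ℍ, u • g • z = b +ᵥ u • z := by
  obtain ⟨z₀, hz₀⟩ := h1
  have hdet := g.det_coe
  rw [Matrix.det_fin_two] at hdet
  -- It suffices to show that `u * g = ± T * u` for a translation matrix `T`.
  suffices key : ∃ (u : SL(2, ℝ)) (b ε : ℝ), (ε = 1 ∨ ε = -1) ∧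
      u 0 0 * g 0 0 + u 0 1 * g 1 0 = ε * (u 0 0 + b * u 1 0) ∧
      u 0 0 * g 0 1 + u 0 1 * g 1 1 = ε * (u 0 1 + b * u 1 1) ∧
      u 1 0 * g 0 0 + u 1 1 * g 1 0 = ε * u 1 0 ∧
      u 1 0 * g 0 1 + u 1 1 * g 1 1 = ε * u 1 1 by
    obtain ⟨u, b, ε, hε, e1, e2, e3, e4⟩ := key
    have htr : ∀ z : ℍ, u • g • z = b +ᵥ u • z := by
      intro z
      apply UpperHalfPlane.ext
      have hd : ((u 1 0 : ℝ) : ℂ) * z + ((u 1 1 : ℝ) : ℂ) ≠ 0 := by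
        have := UpperHalfPlane.denom_ne_zero (u : GL (Fin 2) ℝ) z
        simpa [UpperHalfPlane.denom] using this
      have hε0 : (ε : ℂ) ≠ 0 := by
        rcases hε with rfl | rfl <;> simp
      rw [smul_smul, UpperHalfPlane.coe_vadd, UpperHalfPlane.coe_specialLinearGroup_apply,
        UpperHalfPlane.coe_specialLinearGroup_apply]
      simp only [Matrix.SpecialLinearGroup.coe_mul, Matrix.mul_apply, Fin.sum_univ_two,
        e1, e2, e3, e4, Algebra.algebraMap_self, RingHom.id_apply, Complex.ofReal_mul,
        Complex.ofReal_add]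
      have hd2 : (ε : ℂ) * (u 1 0 : ℝ) * z + ε * (u 1 1 : ℝ) ≠ 0 := by
        rw [mul_assoc, ← mul_add]
        exact mul_ne_zero hε0 hd
      field_simp
      ring
    refine ⟨u, b, ?_, htr⟩
    rintro rfl
    have := htr z₀
    rw [zero_vadd] at this
    exact hz₀ ((MulAction.injective u) this)
  have hε2 : ((g 0 0 + g 1 1) / 2) * ((g 0 0 + g 1 1) / 2) = 1 := by nlinarith
  have hε := mul_self_eq_one_iff.1 hε2
  by_cases hc : g 1 0 = 0
  · rw [hc] at hdet
    have had : g 0 0 = g 1 1 := by nlinarith [sq_nonneg (g 0 0 - g 1 1)]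
    refine ⟨1, (g 0 0 + g 1 1) / 2 * g 0 1, _, hε, ?_⟩
    simp [hc, had]
    rw [had] at hε2
    linear_combination -(g 0 1) * hε2
  · have hu : (!![0, -1; 1, -((g 0 0 - g 1 1) / (2 * g 1 0))] : Matrix (Fin 2) (Fin 2) ℝ).det
        = 1 := by
      simp [Matrix.det_fin_two]
    refine ⟨⟨_, hu⟩, -((g 0 0 + g 1 1) / 2 * g 1 0), _, hε, ?_⟩
    simp
    have hr : g 1 0 * ((g 0 0 - g 1 1) / (2 * g 1 0)) = (g 0 0 - g 1 1) / 2 := by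
      field_simp
    refine ⟨?_, ?_, ?_, ?_⟩
    · linear_combination -(g 1 0) * hε2
    · linear_combination -(g 1 0 * ((g 0 0 - g 1 1) / (2 * g 1 0))) * hε2 - hr
    · field_simp
      ring
    · field_simp
      nlinarith

/-- The midpoint of a point and its horizontal translate by `t` has height at least `|t| / 2`. -/
lemma exists_midpoint_vadd (z : ℍ) (t : ℝ) :
    ∃ w : ℍ, dist z w + dist w (t +ᵥ z) = dist z (t +ᵥ z) ∧ |t| / 2 ≤ w.im := by
  have hy := z.im_pos
  have hpos : 0 < z.im ^ 2 + (t / 2) ^ 2 := by positivity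
  have hR : 0 < Real.sqrt (z.im ^ 2 + (t / 2) ^ 2) := Real.sqrt_pos.2 hpos
  have hR2 := Real.sq_sqrt hpos.le
  have hRt : |t| / 2 ≤ Real.sqrt (z.im ^ 2 + (t / 2) ^ 2) := by
    apply Real.le_sqrt_of_sq_le
    rw [div_pow, sq_abs, div_pow]
    nlinarith
  set R := Real.sqrt (z.im ^ 2 + (t / 2) ^ 2)
  let w : ℍ := ⟨⟨z.re + t / 2, R⟩, hR⟩
  have hw1 : w.re = z.re + t / 2 := rfl
  have hw2 : w.im = R := rfl
  have ht1 : (t +ᵥ z).re = t + z.re := UpperHalfPlane.vadd_re t z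
  have ht2 : (t +ᵥ z).im = z.im := UpperHalfPlane.vadd_im t z
  have inj : ∀ x y : ℝ, 0 ≤ x → 0 ≤ y → Real.cosh x = Real.cosh y → x = y := by
    intro x y hx hy h
    have h1 := Real.cosh_le_cosh.1 h.le
    have h2 := Real.cosh_le_cosh.1 h.ge
    rw [abs_of_nonneg hx, abs_of_nonneg hy] at h1 h2
    exact le_antisymm h1 h2
  have c1 : Real.cosh (dist z w) = R / z.im := by
    rw [UpperHalfPlane.cosh_dist', hw1, hw2]
    field_simp
    nlinarith
  have c2 : Real.cosh (dist w (t +ᵥ z)) = R / z.im := by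
    rw [UpperHalfPlane.cosh_dist', hw1, hw2, ht1, ht2]
    field_simp
    nlinarith
  have c3 : Real.cosh (dist z (t +ᵥ z)) = 2 * (R / z.im) ^ 2 - 1 := by
    rw [UpperHalfPlane.cosh_dist', ht1, ht2]
    field_simp
    nlinarith
  refine ⟨w, ?_, hRt⟩
  have e1 := inj _ _ dist_nonneg dist_nonneg (c1.trans c2.symm)
  rw [← e1, ← two_mul]
  apply inj _ _ (by positivity) dist_nonneg
  rw [Real.cosh_two_mul, Real.sinh_sq, c1, c3]
  ring

/-- An abelian convex cocompact group contains no parabolic element `g`: the displacement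
`z ↦ dist z (g z)` is bounded below on the convex set, as it is invariant and the quotient is
compact, but it tends to `0` along the midpoints of `z` and `g ^ n z`. -/
lemma not_translation {Γ : Subgroup SL(2, ℝ)} (hcc : ConvexCocompact Γ)
    (habelian : ∀ a ∈ Γ, ∀ b ∈ Γ, a * b = b * a) {g : SL(2, ℝ)} (hg : g ∈ Γ)
    {u : SL(2, ℝ)} {b : ℝ} (hb : b ≠ 0) (hu : ∀ z : ℍ, u • g • z = b +ᵥ u • z) : False := by
  obtain ⟨C, ⟨z₀, hz₀⟩, -, hconv, hinv, K, hK, hCK⟩ := hcc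
  have hfix : ∀ z : ℍ, g • z ≠ z := by
    intro z hz
    have h1 := congrArg UpperHalfPlane.re (hu z)
    rw [hz, UpperHalfPlane.vadd_re] at h1
    exact hb (by linarith)
  have hKne : K.Nonempty := by
    obtain ⟨γ, -, hγ⟩ := hCK z₀ hz₀
    exact ⟨_, hγ⟩
  obtain ⟨k₀, -, hk₀⟩ := hK.exists_isMinOn hKne (f := fun z : ℍ => dist z (g • z))
    (continuous_id.dist (continuous_const_smul g)).continuousOn
  have hδ : 0 < dist k₀ (g • k₀) := dist_pos.2 (hfix k₀).symm
  set δ := dist k₀ (g • k₀)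
  have hC : ∀ z ∈ C, δ ≤ dist z (g • z) := by
    intro z hz
    obtain ⟨γ, hγ, hγz⟩ := hCK z hz
    have h1 : δ ≤ dist (γ • z) (g • γ • z) := hk₀ hγz
    rwa [smul_smul, habelian g hg γ hγ, ← smul_smul, dist_smul] at h1
  clear_value δ
  have hpow : ∀ n : ℕ, u • g ^ n • z₀ = ((n : ℝ) * b) +ᵥ u • z₀ := by
    intro n
    induction n with
    | zero => simp
    | succ n ih =>
      rw [pow_succ', ← smul_smul, hu, ih, vadd_vadd]
      congr 1
      push_cast
      ring
  have hbound : ∀ n : ℕ, Real.sinh (δ / 2) * n ≤ 1 := by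
    intro n
    obtain ⟨w, hw1, hw2⟩ := exists_midpoint_vadd (u • z₀) ((n : ℝ) * b)
    have hwC : u⁻¹ • w ∈ C := by
      refine hconv z₀ hz₀ (g ^ n • z₀) (hinv _ (Γ.pow_mem hg n) _ hz₀) _ ?_
      rw [← hpow] at hw1
      rw [← dist_smul u z₀, ← dist_smul u (u⁻¹ • w), ← dist_smul u z₀, smul_inv_smul]
      exact hw1
    have h1 := hC _ hwC
    rw [← dist_smul u, hu, smul_inv_smul] at h1
    have h2 : Real.sinh (δ / 2) ≤ |b| / (2 * w.im) := by
      have h3 : Real.sinh (δ / 2) ≤ Real.sinh (dist w (b +ᵥ w) / 2) :=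
        Real.sinh_le_sinh.2 (by linarith)
      rw [UpperHalfPlane.sinh_half_dist, UpperHalfPlane.vadd_im, Real.sqrt_mul_self w.im_pos.le,
        UpperHalfPlane.coe_vadd, dist_comm, dist_eq_norm, add_sub_cancel_right,
        Complex.norm_real, Real.norm_eq_abs] at h3
      exact h3
    rw [le_div_iff₀ (by have := w.im_pos; positivity)] at h2
    rw [abs_mul, Nat.abs_cast] at hw2
    have hsinh : 0 < Real.sinh (δ / 2) := Real.sinh_pos_iff.2 (by linarith)
    have hb' : 0 < |b| := abs_pos.2 hb
    have h4 : (Real.sinh (δ / 2) * n) * |b| ≤ 1 * |b| := by nlinarith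
    exact le_of_mul_le_mul_right h4 hb'
  have hsinh : 0 < Real.sinh (δ / 2) := Real.sinh_pos_iff.2 (by linarith)
  obtain ⟨n, hn⟩ := exists_nat_gt (1 / Real.sinh (δ / 2))
  rw [div_lt_iff₀ hsinh] at hn
  linarith [hbound n]

/-- In an abelian convex co-compact group that acts freely, nontrivial elements are hyperbolic. -/
lemma trace_sq_gt {Γ : Subgroup SL(2, ℝ)} (hfree : ActsFreely Γ) (hcc : ConvexCocompact Γ)
    (habelian : ∀ a ∈ Γ, ∀ b ∈ Γ, a * b = b * a) {g : SL(2, ℝ)} (hg : g ∈ Γ) (hg1 : g ≠ 1) :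
    4 < (g 0 0 + g 1 1) ^ 2 := by
  by_contra! h
  rcases h.lt_or_eq with h | h
  · obtain ⟨z, hz⟩ := exists_fixed_of_trace_lt g h
    exact hg1 (hfree g hg z hz)
  · obtain ⟨u, b, hb, hu⟩ := exists_translation_of_trace_eq g h
      ⟨UpperHalfPlane.I, fun hz => hg1 (hfree g hg _ hz)⟩
    exact not_translation hcc habelian hg hb hu

end NoEllipticOrParabolic

/-! ### Fixed points on the circle -/

section FixedPoints

lemma mob_eq_self_iff (g : SL(2, ℝ)) {z : ℂ} (hz : ‖z‖ ≤ 1) :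
    mob g z = z ↔ star (suB g) * z ^ 2 + (star (suA g) - suA g) * z - suB g = 0 := by
  rw [mob, div_eq_iff (den_ne_zero g hz), den]
  constructor <;> intro h <;> linear_combination -h

/-- An element that commutes with `g` fixes the fixed points of `g`. -/
lemma mob_eq_self_of_commute {g h : SL(2, ℝ)} (hgh : g * h = h * g) (hB : suB g ≠ 0) {z : ℂ}
    (hz : ‖z‖ ≤ 1) (hg : mob g z = z) : mob h z = z := by
  rw [mob_eq_self_iff _ hz] at hg ⊢
  have h1 := suA_mul g h
  have h2 := suB_mul g h
  rw [hgh, suA_mul] at h1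
  rw [hgh, suB_mul] at h2
  apply mul_left_cancel₀ hB
  linear_combination (suB h) * hg - z ^ 2 * h1 - z * h2

lemma re_suA (g : SL(2, ℝ)) : (suA g).re = (g 0 0 + g 1 1) / 2 := rfl

/-- A hyperbolic element has two fixed points on the circle. -/
lemma exists_fixed_pair_of_trace (g : SL(2, ℝ)) (h : 4 < (g 0 0 + g 1 1) ^ 2) :
    suB g ≠ 0 ∧ ∃ p q : Circle, p ≠ q ∧ mob g p = p ∧ mob g q = q := by
  have hA := re_suA g
  have hre : 1 < (suA g).re ^ 2 := by rw [hA]; nlinarith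
  have hdet := su_normSq g
  rw [← Complex.normSq_eq_norm_sq, ← Complex.normSq_eq_norm_sq, Complex.normSq_apply,
    Complex.normSq_apply] at hdet
  have hBn : 0 < (suB g).re * (suB g).re + (suB g).im * (suB g).im := by nlinarith
  have hB : suB g ≠ 0 := by
    intro h0
    rw [h0] at hBn
    simp at hBn
  refine ⟨hB, ?_⟩
  have hs : 0 < Real.sqrt ((suA g).re ^ 2 - 1) := Real.sqrt_pos.2 (by linarith)
  have hs2 := Real.sq_sqrt (show 0 ≤ (suA g).re ^ 2 - 1 by linarith)
  set s := Real.sqrt ((suA g).re ^ 2 - 1)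
  have hsB : star (suB g) ≠ 0 := star_ne_zero.2 hB
  -- The fixed points are `(i Im α ± s) / conj β`, where `s ^ 2 = (Re α) ^ 2 - 1`.
  have key : ∀ t : ℝ, t ^ 2 = (suA g).re ^ 2 - 1 →
      ‖(⟨t, (suA g).im⟩ : ℂ) / star (suB g)‖ = 1 ∧
      mob g ((⟨t, (suA g).im⟩ : ℂ) / star (suB g)) = (⟨t, (suA g).im⟩ : ℂ) / star (suB g) := by
    intro t ht
    have hn : ‖(⟨t, (suA g).im⟩ : ℂ) / star (suB g)‖ = 1 := by
      rw [norm_div, norm_star, div_eq_one_iff_eq (norm_ne_zero_iff.2 hB), ← sq_eq_sq₀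
        (norm_nonneg _) (norm_nonneg _), ← Complex.normSq_eq_norm_sq, ← Complex.normSq_eq_norm_sq,
        Complex.normSq_apply, Complex.normSq_apply]
      simp only
      nlinarith
    refine ⟨hn, (mob_eq_self_iff g hn.le).2 ?_⟩
    apply mul_left_cancel₀ hsB
    field_simp
    apply Complex.ext
    · simp
      nlinarith
    · simp
      ring
  obtain ⟨n1, f1⟩ := key s hs2
  obtain ⟨n2, f2⟩ := key (-s) (by rw [neg_sq]; exact hs2)
  refine ⟨⟨_, mem_sphere_zero_iff_norm.2 n1⟩, ⟨_, mem_sphere_zero_iff_norm.2 n2⟩, ?_, f1, f2⟩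
  intro h
  have h1 := congrArg (fun z : Circle => (z : ℂ)) h
  have h2 : (⟨s, (suA g).im⟩ : ℂ) = ⟨-s, (suA g).im⟩ := (div_left_inj' hsB).1 h1
  have h3 := congrArg Complex.re h2
  simp only at h3
  linarith

lemma star_den_of_fixed {g : SL(2, ℝ)} {p : Circle} (h : mob g p = p) :
    star (den g p) = den g p := by
  have h1 := norm_num_eq g (Circle.norm_coe p)
  have h2 := den_ne_zero g (Circle.norm_coe p).le
  rw [mob, div_eq_iff h2, h1] at h
  exact mul_left_cancel₀ (Circle.coe_ne_zero p) h

/-- The denominator of `g` at a fixed point on the circle is real: it is an eigenvalue of `g`. -/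
lemma den_eq_re_of_fixed {g : SL(2, ℝ)} {p : Circle} (h : mob g p = p) :
    den g p = ((den g p).re : ℂ) :=
  (Complex.conj_eq_iff_re.1 (star_den_of_fixed h)).symm

lemma mob_sub_mob (g : SL(2, ℝ)) {z w : ℂ} (hz : den g z ≠ 0) (hw : den g w ≠ 0) :
    mob g z - mob g w = (z - w) / (den g z * den g w) := by
  rw [mob, mob, div_sub_div _ _ hz hw]
  congr 1
  simp only [den]
  linear_combination (z - w) * su_det g

lemma den_mul_den {g : SL(2, ℝ)} {p q : Circle} (hpq : p ≠ q) (hp : mob g p = p)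
    (hq : mob g q = q) : den g p * den g q = 1 := by
  have h1 := den_ne_zero g (Circle.norm_coe p).le
  have h2 := den_ne_zero g (Circle.norm_coe q).le
  have h := mob_sub_mob g h1 h2
  have hpq' : (p : ℂ) - q ≠ 0 := sub_ne_zero.2 (fun h => hpq (Circle.ext h))
  rw [hp, hq, eq_div_iff (mul_ne_zero h1 h2)] at h
  exact mul_left_cancel₀ hpq' (by rw [h, mul_one])

lemma den_mul_of_fixed (g : SL(2, ℝ)) {h : SL(2, ℝ)} {q : Circle} (hq : mob h q = q) :
    den (g * h) q = den g q * den h q := by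
  rw [den_mul g h (Circle.norm_coe q).le, hq]

lemma one_sub_norm_mob_sq (g : SL(2, ℝ)) {z : ℂ} (hz : den g z ≠ 0) :
    1 - ‖mob g z‖ ^ 2 = (1 - ‖z‖ ^ 2) / ‖den g z‖ ^ 2 := by
  have h0 : ‖den g z‖ ≠ 0 := norm_ne_zero_iff.2 hz
  rw [mob, norm_div, div_pow, eq_div_iff (pow_ne_zero 2 h0), sub_mul,
    div_mul_cancel₀ _ (pow_ne_zero 2 h0), one_mul]
  have h1 : ∀ w : ℂ, ((‖w‖ ^ 2 : ℝ) : ℂ) = w * star w := fun w => by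
    simpa using (Complex.mul_conj' w).symm
  have : ((‖den g z‖ ^ 2 - ‖suA g * z + suB g‖ ^ 2 : ℝ) : ℂ) = ((1 - ‖z‖ ^ 2 : ℝ) : ℂ) := by
    rw [Complex.ofReal_sub, Complex.ofReal_sub, h1, h1, h1]
    simp only [den, star_add, star_mul', star_star, Complex.ofReal_one]
    linear_combination (1 - z * star z) * su_det g
  exact_mod_cast this

end FixedPoints

/-! ### The limit set of a group with two common fixed points -/

section LimitSet

variable {Γ : Subgroup SL(2, ℝ)} {p q : Circle}

/-- The limit set contains at most the common fixed points: the orbits lie on curves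
`1 - |z|² = b |z - p| |z - q|` with `b > 0`, which meet the circle in `p` and `q` only. -/
lemma limitSet_subset_of_fixed (hpq : p ≠ q) (hp : ∀ γ ∈ Γ, mob γ p = p)
    (hq : ∀ γ ∈ Γ, mob γ q = q) : limitSet Γ ⊆ {p, q} := by
  rintro r ⟨x, hx⟩
  have hx1 := norm_cayley_lt x
  have hne : ∀ t : Circle, 0 < ‖cayley x - t‖ := by
    intro t
    rw [norm_pos_iff, sub_ne_zero]
    rintro h
    rw [h, Circle.norm_coe] at hx1
    exact lt_irrefl _ hx1
  set b : ℝ := (1 - ‖cayley x‖ ^ 2) / (‖cayley x - p‖ * ‖cayley x - q‖)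
  have hb : 0 < b := by
    have := hne p
    have := hne q
    have : 0 < 1 - ‖cayley x‖ ^ 2 := by nlinarith [norm_nonneg (cayley x)]
    positivity
  have hclosed : IsClosed {z : ℂ | 1 - ‖z‖ ^ 2 = b * (‖z - p‖ * ‖z - q‖)} :=
    isClosed_eq (by fun_prop) (by fun_prop)
  have hsub : {w | ∃ γ ∈ Γ, w = cayley (γ • x)} ⊆
      {z : ℂ | 1 - ‖z‖ ^ 2 = b * (‖z - p‖ * ‖z - q‖)} := by
    rintro _ ⟨γ, hγ, rfl⟩
    have hdx := den_ne_zero γ hx1.le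
    have hdp := den_ne_zero γ (Circle.norm_coe p).le
    have hdq := den_ne_zero γ (Circle.norm_coe q).le
    have e1 := mob_sub_mob γ hdx hdp
    have e2 := mob_sub_mob γ hdx hdq
    have e3 := congrArg norm (den_mul_den hpq (hp γ hγ) (hq γ hγ))
    rw [hp γ hγ] at e1
    rw [hq γ hγ] at e2
    rw [norm_mul, norm_one] at e3
    have h0 := norm_ne_zero_iff.2 hdx
    have h1 := norm_ne_zero_iff.2 hdp
    have h2 := norm_ne_zero_iff.2 hdq
    have h3 := (hne p).ne'
    have h4 := (hne q).ne'
    simp only [Set.mem_ofPred_eq]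
    rw [cayley_smul, one_sub_norm_mob_sq γ hdx, e1, e2, norm_div, norm_div, norm_mul, norm_mul]
    calc _ = b * (‖cayley x - p‖ * ‖cayley x - q‖) / ‖den γ (cayley x)‖ ^ 2 := by
          rw [div_mul_cancel₀ _ (mul_ne_zero h3 h4)]
      _ = b * (‖cayley x - p‖ * ‖cayley x - q‖) /
          (‖den γ (cayley x)‖ ^ 2 * (‖den γ p‖ * ‖den γ q‖)) := by rw [e3, mul_one]
      _ = _ := by field_simp
  have hmem : (r : ℂ) ∈ {z : ℂ | 1 - ‖z‖ ^ 2 = b * (‖z - p‖ * ‖z - q‖)} :=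
    closure_minimal hsub hclosed (mem_closure_iff_clusterPt.2 hx.clusterPt)
  simp only [Set.mem_ofPred_eq, Circle.norm_coe, one_pow, sub_self, zero_eq_mul, mul_eq_zero,
    hb.ne', false_or, norm_eq_zero, sub_eq_zero] at hmem
  rcases hmem with h | h
  · exact Or.inl (Circle.ext h)
  · exact Or.inr (Circle.ext h)

lemma norm_den_pow {g : SL(2, ℝ)} (hp : mob g p = p) (n : ℕ) :
    ‖den (g ^ n) p‖ = ‖den g p‖ ^ n := by
  induction n with
  | zero => simp [den, suA_one, suB_one]
  | succ n ih => rw [pow_succ, den_mul_of_fixed _ hp, norm_mul, ih, pow_succ]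

/-- A common fixed point at which some element of `Γ` has a nontrivial multiplier is a limit
point. -/
lemma mem_limitSet_of_fixed (hp : ∀ γ ∈ Γ, mob γ p = p) {g : SL(2, ℝ)} (hg : g ∈ Γ)
    (h1 : ‖den g p‖ ≠ 1) : p ∈ limitSet Γ := by
  -- Choose the one of `g`, `g⁻¹` that contracts towards `p`.
  obtain ⟨g, hg, h1⟩ : ∃ g ∈ Γ, 1 < ‖den g p‖ := by
    rcases lt_or_gt_of_ne h1 with h | h
    · refine ⟨g⁻¹, Γ.inv_mem hg, ?_⟩
      have h2 := congrArg norm (den_mul_of_fixed g⁻¹ (hp g hg))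
      have h3 : ‖den 1 (p : ℂ)‖ = 1 := by simp [den, suA_one, suB_one]
      rw [inv_mul_cancel, norm_mul, h3] at h2
      have h4 : 0 < ‖den g p‖ := norm_pos_iff.2 (den_ne_zero g (Circle.norm_coe p).le)
      by_contra! h5
      nlinarith
    · exact ⟨g, hg, h⟩
  refine ⟨UpperHalfPlane.I, ?_⟩
  have hI : cayley UpperHalfPlane.I = 0 := by simp [cayley]
  rw [accPt_iff_nhds]
  intro U hU
  obtain ⟨ε, hε, hεU⟩ := Metric.mem_nhds_iff.1 hU
  obtain ⟨n, hn⟩ := pow_unbounded_of_one_lt (1 / ε) h1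
  rw [← norm_den_pow (hp g hg)] at hn
  have hgn := Γ.pow_mem hg n
  set γ := g ^ n
  refine ⟨cayley (γ • UpperHalfPlane.I), ⟨hεU ?_, γ, hgn, rfl⟩, ?_⟩
  · have h0 : den γ 0 ≠ 0 := den_ne_zero γ (by simp)
    have h2 := mob_sub_mob γ h0 (den_ne_zero γ (Circle.norm_coe p).le)
    have h3 : 1 ≤ ‖den γ 0‖ := by
      have := su_normSq γ
      simp only [den, mul_zero, zero_add, norm_star]
      nlinarith [norm_nonneg (suA γ), sq_nonneg ‖suB γ‖]
    rw [hp γ hgn] at h2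
    rw [cayley_smul, hI, mem_ball_iff_norm, h2, norm_div, zero_sub, norm_neg, Circle.norm_coe,
      norm_mul, div_lt_iff₀ (mul_pos (by linarith)
        (norm_pos_iff.2 (den_ne_zero γ (Circle.norm_coe p).le)))]
    rw [div_lt_iff₀ hε] at hn
    have : 0 ≤ ‖den γ p‖ * ε := by positivity
    nlinarith
  · intro h
    have h2 := norm_cayley_lt (γ • UpperHalfPlane.I)
    rw [h, Circle.norm_coe] at h2
    exact lt_irrefl _ h2

end LimitSet

/-! ### Cyclicity -/

section Generator

variable {Γ : Subgroup SL(2, ℝ)} {p q : Circle}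

/-- The entries of `g` in terms of the entries `α` and `β` of its conjugate in `SU(1, 1)`. -/
def suMatrix (α β : ℂ) : Matrix (Fin 2) (Fin 2) ℝ :=
  !![α.re + β.re, α.im - β.im; -α.im - β.im, α.re - β.re]

lemma suMatrix_suA_suB (g : SL(2, ℝ)) : suMatrix (suA g) (suB g) = g := by
  ext i j
  fin_cases i <;> fin_cases j <;> simp [suMatrix, suA, suB] <;> ring

/-- The entry `β`, recovered from the eigenvalues `exp (-u)` at `p` and `exp u` at `q`. -/
def axisB (p q : Circle) (u : ℝ) : ℂ :=
  star (((Real.exp u - Real.exp (-u) : ℝ) : ℂ) / ((q : ℂ) - p))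

/-- The entry `α`, recovered from the eigenvalues `exp (-u)` at `p` and `exp u` at `q`. -/
def axisA (p q : Circle) (u : ℝ) : ℂ := star ((Real.exp u : ℂ) - star (axisB p q u) * q)

lemma eq_suMatrix_axis (hpq : p ≠ q) {g : SL(2, ℝ)} (hp : mob g p = p) (hq : mob g q = q) {u : ℝ}
    (hu : den g q = (Real.exp u : ℂ)) :
    (g : Matrix (Fin 2) (Fin 2) ℝ) = suMatrix (axisA p q u) (axisB p q u) := by
  have hpq' : (q : ℂ) - p ≠ 0 := sub_ne_zero.2 (fun h => hpq (Circle.ext h.symm))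
  have h1 : den g p = (Real.exp (-u) : ℂ) := by
    have h := den_mul_den hpq hp hq
    rw [hu] at h
    rw [Real.exp_neg, Complex.ofReal_inv]
    exact eq_inv_of_mul_eq_one_left h
  have hB : suB g = axisB p q u := by
    rw [axisB, eq_comm, star_eq_iff_star_eq, eq_div_iff hpq', Complex.ofReal_sub, ← hu, ← h1]
    simp only [den]
    ring
  have hA : suA g = axisA p q u := by
    rw [axisA, ← hB, ← hu, eq_comm, star_eq_iff_star_eq]
    simp only [den]
    ring
  rw [← hA, ← hB, suMatrix_suA_suB]

lemma continuous_suMatrix_axis (p q : Circle) :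
    Continuous fun u : ℝ => suMatrix (axisA p q u) (axisB p q u) := by
  have hB : Continuous (axisB p q) := by
    unfold axisB
    exact continuous_star.comp ((Complex.continuous_ofReal.comp (by fun_prop)).div_const _)
  have hA : Continuous (axisA p q) := by
    unfold axisA
    refine continuous_star.comp (Continuous.sub ?_ ((continuous_star.comp hB).mul_const _))
    exact Complex.continuous_ofReal.comp Real.continuous_exp
  unfold suMatrix
  refine continuous_matrix fun i j => ?_
  fin_cases i <;> fin_cases j <;> simp <;> fun_prop

/-- The logarithm of the multiplier at the common fixed point `q`. -/
def logDen (q : Circle) (g : SL(2, ℝ)) : ℝ := Real.log ‖den g q‖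

lemma logDen_mul (g : SL(2, ℝ)) {h : SL(2, ℝ)} (hq : mob h q = q) :
    logDen q (g * h) = logDen q g + logDen q h := by
  rw [logDen, den_mul_of_fixed g hq, norm_mul, Real.log_mul]
  · rfl
  · exact norm_ne_zero_iff.2 (den_ne_zero g (Circle.norm_coe q).le)
  · exact norm_ne_zero_iff.2 (den_ne_zero h (Circle.norm_coe q).le)

lemma logDen_one : logDen q 1 = 0 := by simp [logDen, den, suA_one, suB_one]

lemma den_sq_of_fixed {g : SL(2, ℝ)} (hq : mob g q = q) :
    den (g * g) q = (Real.exp (2 * logDen q g) : ℂ) := by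
  have h0 : 0 < ‖den g q‖ := norm_pos_iff.2 (den_ne_zero g (Circle.norm_coe q).le)
  rw [den_mul_of_fixed g hq, logDen, two_mul, Real.exp_add, Real.exp_log h0,
    den_eq_re_of_fixed hq, Complex.norm_real, Real.norm_eq_abs, abs_mul_abs_self,
    Complex.ofReal_mul]

/-- A hyperbolic element has a nontrivial multiplier at its fixed points. -/
lemma eq_one_of_logDen_eq_zero (hpq : p ≠ q) {g : SL(2, ℝ)}
    (htr : g ≠ 1 → 4 < (g 0 0 + g 1 1) ^ 2) (hp : mob g p = p) (hq : mob g q = q)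
    (h : logDen q g = 0) : g = 1 := by
  by_contra hg
  have h4 := htr hg
  have h0 : 0 < ‖den g q‖ := norm_pos_iff.2 (den_ne_zero g (Circle.norm_coe q).le)
  have hsq := den_sq_of_fixed hq
  rw [h, mul_zero, Real.exp_zero, den_mul_of_fixed g hq, Complex.ofReal_one] at hsq
  have hpp : den g p = den g q := by
    have h1 := den_mul_den hpq hp hq
    exact mul_right_cancel₀ (norm_pos_iff.1 h0) (h1.trans hsq.symm)
  have hpq' : (p : ℂ) - q ≠ 0 := sub_ne_zero.2 (fun h => hpq (Circle.ext h))
  have hB : star (suB g) = 0 := by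
    apply (mul_eq_zero.1 _).resolve_right hpq'
    simp only [den] at hpp
    linear_combination hpp
  rw [den, hB, zero_mul, zero_add, mul_self_eq_one_iff] at hsq
  have hre : (suA g).re ^ 2 = 1 := by
    rcases hsq with h | h
    · have := congrArg Complex.re h
      simp at this
      rw [this, one_pow]
    · have := congrArg Complex.re h
      simp at this
      rw [this]
      norm_num
  rw [re_suA] at hre
  linarith

/-- A discrete group with two common fixed points on the circle, and without nontrivial elements
of trace `±2`, is cyclic. -/
lemma exists_generator [hdisc : DiscreteTopology Γ] (hpq : p ≠ q)
    (htr : ∀ γ ∈ Γ, γ ≠ 1 → 4 < (γ 0 0 + γ 1 1) ^ 2) (hp : ∀ γ ∈ Γ, mob γ p = p)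
    (hq : ∀ γ ∈ Γ, mob γ q = q) : ∃ γ₀ ∈ Γ, ∀ γ ∈ Γ, ∃ n : ℤ, γ₀ ^ n = γ := by
  have hinj : ∀ γ ∈ Γ, logDen q γ = 0 → γ = 1 := fun γ hγ =>
    eq_one_of_logDen_eq_zero hpq (htr γ hγ) (hp γ hγ) (hq γ hγ)
  have hinv : ∀ γ ∈ Γ, logDen q γ⁻¹ = -logDen q γ := by
    intro γ hγ
    have := logDen_mul γ⁻¹ (hq γ hγ)
    rw [inv_mul_cancel, logDen_one] at this
    linarith
  let H : AddSubgroup ℝ :=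
    { carrier := {x | ∃ γ ∈ Γ, logDen q γ = x}
      add_mem' := by
        rintro _ _ ⟨g, hg, rfl⟩ ⟨h, hh, rfl⟩
        exact ⟨g * h, Γ.mul_mem hg hh, logDen_mul g (hq h hh)⟩
      zero_mem' := ⟨1, Γ.one_mem, logDen_one⟩
      neg_mem' := by
        rintro _ ⟨g, hg, rfl⟩
        exact ⟨g⁻¹, Γ.inv_mem hg, hinv g hg⟩ }
  -- Discreteness of `Γ` isolates `0` in the group of logarithms of multipliers.
  obtain ⟨W, hW, hW1, hWΓ⟩ : ∃ W : Set (Matrix (Fin 2) (Fin 2) ℝ), IsOpen W ∧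
      (1 : Matrix (Fin 2) (Fin 2) ℝ) ∈ W ∧
      ∀ γ ∈ Γ, (γ : Matrix (Fin 2) (Fin 2) ℝ) ∈ W → γ = 1 := by
    have h1 : IsOpen ({1} : Set Γ) := isOpen_discrete _
    obtain ⟨V, hV, hV1⟩ := isOpen_induced_iff.1 h1
    obtain ⟨W, hW, rfl⟩ := isOpen_induced_iff.1 hV
    exact ⟨W, hW, (Set.ext_iff.1 hV1 1).2 rfl, fun γ hγ hγW =>
      congrArg Subtype.val ((Set.ext_iff.1 hV1 ⟨γ, hγ⟩).1 hγW)⟩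
  have haxis0 : suMatrix (axisA p q 0) (axisB p q 0) = 1 := by
    have h1 : mob 1 (p : ℂ) = p := by simp [mob, den, suA_one, suB_one]
    have h2 : mob 1 (q : ℂ) = q := by simp [mob, den, suA_one, suB_one]
    exact (eq_suMatrix_axis hpq h1 h2 (u := 0) (by simp [den, suA_one, suB_one])).symm
  obtain ⟨ε, hε, hball⟩ := Metric.mem_nhds_iff.1
    ((hW.preimage (continuous_suMatrix_axis p q)).mem_nhds
      (show (0 : ℝ) ∈ _ by rw [Set.mem_preimage, haxis0]; exact hW1))
  have hiso : Disjoint (H : Set ℝ) (Set.Ioo 0 (ε / 2)) := by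
    rw [Set.disjoint_left]
    rintro _ ⟨γ, hγ, rfl⟩ ⟨h1, h2⟩
    have h3 : (2 * logDen q γ) ∈ Metric.ball (0 : ℝ) ε := by
      rw [mem_ball_zero_iff, Real.norm_eq_abs, abs_of_pos (by linarith)]
      linarith
    have h4 := hball h3
    have hγγ := Γ.mul_mem hγ hγ
    rw [Set.mem_preimage, ← eq_suMatrix_axis hpq (hp _ hγγ) (hq _ hγγ)
      (den_sq_of_fixed (hq γ hγ))] at h4
    have h5 := logDen_mul γ (hq γ hγ)
    rw [hWΓ _ hγγ h4, logDen_one] at h5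
    linarith
  obtain ⟨b, hb⟩ := AddSubgroup.cyclic_of_isolated_zero (half_pos hε) hiso
  obtain ⟨γ₀, hγ₀, hγ₀b⟩ : b ∈ H := hb ▸ AddSubgroup.mem_closure_singleton_self b
  refine ⟨γ₀, hγ₀, fun γ hγ => ?_⟩
  have h1 : logDen q γ ∈ H := ⟨γ, hγ, rfl⟩
  rw [hb, AddSubgroup.mem_closure_singleton] at h1
  obtain ⟨n, hn⟩ := h1
  have hz : ∀ n : ℤ, logDen q (γ₀ ^ n) = n * b := by
    intro n
    induction n with
    | zero => simp [logDen_one]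
    | succ n ih =>
      rw [zpow_add_one, logDen_mul _ (hq _ hγ₀), ih, hγ₀b]
      push_cast
      ring
    | pred n ih =>
      rw [zpow_sub_one, logDen_mul _ (hq _ (Γ.inv_mem hγ₀)), ih, hinv _ hγ₀, hγ₀b]
      push_cast
      ring
  refine ⟨n, ?_⟩
  have h2 : γ⁻¹ * γ₀ ^ n ∈ Γ := Γ.mul_mem (Γ.inv_mem hγ) (Γ.zpow_mem hγ₀ n)
  have h3 := hinj _ h2 (by
    rw [logDen_mul _ (hq _ (Γ.zpow_mem hγ₀ n)), hinv γ hγ, hz, ← hn]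
    simp)
  exact (inv_mul_eq_one.1 h3).symm

/-- The group is cyclic, its limit set consists of two points, it fixes both, and
a generator has a nontrivial multiplier there. -/
theorem exists_axis [DiscreteTopology Γ] (hfree : ActsFreely Γ) (hcc : ConvexCocompact Γ)
    (hnontrivial : Γ ≠ ⊥) (habelian : ∀ a ∈ Γ, ∀ b ∈ Γ, a * b = b * a) :
    ∃ p q : Circle, p ≠ q ∧ limitSet Γ = {p, q} ∧ (∀ γ ∈ Γ, mob γ p = p) ∧
      (∀ γ ∈ Γ, mob γ q = q) ∧
      ∃ γ₀ ∈ Γ, (∀ γ ∈ Γ, ∃ n : ℤ, γ₀ ^ n = γ) ∧ ‖den γ₀ q‖ ≠ 1 := by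
  have htr : ∀ γ ∈ Γ, γ ≠ 1 → 4 < (γ 0 0 + γ 1 1) ^ 2 := fun γ hγ =>
    trace_sq_gt hfree hcc habelian hγ
  obtain ⟨g, hg, hg1⟩ := Γ.bot_or_exists_ne_one.resolve_left hnontrivial
  obtain ⟨hB, p, q, hpq, hgp, hgq⟩ := exists_fixed_pair_of_trace g (htr g hg hg1)
  have hp : ∀ γ ∈ Γ, mob γ p = p := fun γ hγ =>
    mob_eq_self_of_commute (habelian g hg γ hγ) hB (Circle.norm_coe p).le hgp
  have hq : ∀ γ ∈ Γ, mob γ q = q := fun γ hγ =>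
    mob_eq_self_of_commute (habelian g hg γ hγ) hB (Circle.norm_coe q).le hgq
  obtain ⟨γ₀, hγ₀, hgen⟩ := exists_generator hpq htr hp hq
  have hγ₀1 : γ₀ ≠ 1 := by
    rintro rfl
    obtain ⟨n, hn⟩ := hgen g hg
    exact hg1 (by rw [← hn, one_zpow])
  have hden : ‖den γ₀ q‖ ≠ 1 := by
    intro h
    exact hγ₀1 (eq_one_of_logDen_eq_zero hpq (htr _ hγ₀) (hp _ hγ₀) (hq _ hγ₀)
      (by rw [logDen, h, Real.log_one]))
  have hden' : ‖den γ₀ p‖ ≠ 1 := by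
    intro h
    have h1 := congrArg norm (den_mul_den hpq (hp _ hγ₀) (hq _ hγ₀))
    rw [norm_mul, h, one_mul, norm_one] at h1
    exact hden h1
  refine ⟨p, q, hpq, ?_, hp, hq, γ₀, hγ₀, hgen, hden⟩
  refine (limitSet_subset_of_fixed hpq hp hq).antisymm ?_
  rintro r (rfl | rfl)
  · exact mem_limitSet_of_fixed hp hγ₀ hden'
  · exact mem_limitSet_of_fixed hq hγ₀ hden

end Generator

/-! ### A coordinate adapted to two points of the circle -/

section AxisCoordinate

/-- The constant `c` for which `c (z - p) / (z - q)` is a coordinate on the Riemann sphere that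
vanishes at `p`, has its pole at `q` and is real on the circle. It is normalized so that exchanging
`p` and `q` replaces the coordinate `x` by `-1 / x`. -/
def axisConst (p q : Circle) : ℂ := Complex.I * (p - q) / (p * ‖(p : ℂ) - q‖)

/-- The inverse of the coordinate `c (z - p) / (z - q)`. -/
def axisParam (p q : Circle) (x : ℂ) : ℂ := (axisConst p q * p - q * x) / (axisConst p q - x)

/-- The derivative `c z / (z - q) ^ 2` of the coordinate along the rotational vector field, up to a
constant factor, as a function of the coordinate. -/
def axisJac (p q : Circle) (x : ℂ) : ℂ :=
  (axisConst p q * p - q * x) * (axisConst p q - x) / (axisConst p q * ((p : ℂ) - q) ^ 2)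

/-- The section `F ∂ ^ m` of `T ^ m`, written as a function of the coordinate centred at `p` by
means of the coordinate vector field. -/
def localForm (m : ℕ) (p q : Circle) (F : ℂ → ℂ) (x : ℂ) : ℂ :=
  F (axisParam p q x) * axisJac p q x ^ m

variable {p q : Circle}

lemma sub_ne_zero_of_circle_ne (hpq : p ≠ q) : (p : ℂ) - q ≠ 0 :=
  sub_ne_zero.2 (fun h => hpq (Circle.ext h))

lemma norm_axisConst (hpq : p ≠ q) : ‖axisConst p q‖ = 1 := by
  have h := norm_ne_zero_iff.2 (sub_ne_zero_of_circle_ne hpq)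
  rw [axisConst, norm_div, norm_mul, norm_mul, Complex.norm_I, Circle.norm_coe, Complex.norm_real,
    norm_norm, one_mul, div_self h]

lemma axisConst_ne_zero (hpq : p ≠ q) : axisConst p q ≠ 0 :=
  norm_ne_zero_iff.1 (by rw [norm_axisConst hpq]; exact one_ne_zero)

lemma circle_mul_star (p : Circle) : (p : ℂ) * star (p : ℂ) = 1 := by
  have := Complex.mul_conj' (p : ℂ)
  rw [Circle.norm_coe] at this
  simpa using this

lemma axisConst_mul_swap (hpq : p ≠ q) : axisConst p q * axisConst q p = -1 := by
  have h := norm_ne_zero_iff.2 (sub_ne_zero_of_circle_ne hpq)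
  have h1 : ((‖(p : ℂ) - q‖ : ℝ) : ℂ) ≠ 0 := by exact_mod_cast h
  have h2 : ((‖(p : ℂ) - q‖ : ℝ) : ℂ) ^ 2 = (p - q) * star ((p : ℂ) - q) := by
    simpa using (Complex.mul_conj' ((p : ℂ) - q)).symm
  have hp := Circle.coe_ne_zero p
  have hq := Circle.coe_ne_zero q
  rw [axisConst, axisConst, norm_sub_rev (q : ℂ) p, div_mul_div_comm, div_eq_iff (by positivity)]
  have h3 := circle_mul_star p
  have h4 := circle_mul_star q
  have h5 : (p : ℂ) * q * star ((p : ℂ) - q) = q - p := by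
    rw [star_sub]
    linear_combination q * h3 - p * h4
  calc _ = Complex.I * Complex.I * ((p - q) * (q - p)) := by ring
    _ = -(p * q * ((p - q) * star ((p : ℂ) - q))) := by
      rw [Complex.I_mul_I, ← h5]
      ring
    _ = _ := by
      rw [← h2]
      ring

lemma star_axisConst_mul : star (axisConst p q) * q = axisConst p q * p := by
  have hp := Circle.coe_ne_zero p
  have h3 := circle_mul_star p
  have h4 := circle_mul_star q
  have h5 : star (p : ℂ) ≠ 0 := star_ne_zero.2 hp
  have hI : star Complex.I = -Complex.I := Complex.conj_I
  have hn : star ((‖(p : ℂ) - q‖ : ℝ) : ℂ) = ((‖(p : ℂ) - q‖ : ℝ) : ℂ) := Complex.conj_ofReal _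
  rw [axisConst, star_div₀, star_mul', star_mul', star_sub, hI, hn, div_mul_eq_mul_div,
    div_mul_eq_mul_div, ← div_div, ← div_div]
  congr 1
  rw [div_eq_div_iff h5 hp]
  linear_combination -(Complex.I * q + Complex.I * (p - q)) * h3 + Complex.I * p * h4

lemma axisConst_sub_ne_zero (hpq : p ≠ q) {x : ℂ} (hx : ‖x‖ < 1) : axisConst p q - x ≠ 0 := by
  rw [sub_ne_zero]
  rintro h
  rw [← h, norm_axisConst hpq] at hx
  exact lt_irrefl _ hx

lemma axisNum_ne_zero (hpq : p ≠ q) {x : ℂ} (hx : ‖x‖ < 1) :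
    axisConst p q * p - q * x ≠ 0 := by
  rw [sub_ne_zero]
  intro h
  have := congrArg norm h
  rw [norm_mul, norm_mul, norm_axisConst hpq, Circle.norm_coe, Circle.norm_coe, one_mul,
    one_mul] at this
  linarith

lemma axisParam_zero (hpq : p ≠ q) : axisParam p q 0 = p := by
  simp [axisParam, axisConst_ne_zero hpq]

lemma axisParam_ne_zero (hpq : p ≠ q) {x : ℂ} (hx : ‖x‖ < 1) : axisParam p q x ≠ 0 :=
  div_ne_zero (axisNum_ne_zero hpq hx) (axisConst_sub_ne_zero hpq hx)

lemma axisParam_sub_left {x : ℂ} (hx : axisConst p q - x ≠ 0) :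
    axisParam p q x - p = x * (p - q) / (axisConst p q - x) := by
  rw [axisParam, div_sub' hx]
  ring

lemma axisParam_sub_right {x : ℂ} (hx : axisConst p q - x ≠ 0) :
    axisParam p q x - q = axisConst p q * (p - q) / (axisConst p q - x) := by
  rw [axisParam, div_sub' hx]
  ring

lemma axisParam_sub_right_ne_zero (hpq : p ≠ q) {x : ℂ} (hx : axisConst p q - x ≠ 0) :
    axisParam p q x - q ≠ 0 := by
  rw [axisParam_sub_right hx]
  exact div_ne_zero (mul_ne_zero (axisConst_ne_zero hpq) (sub_ne_zero_of_circle_ne hpq)) hx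

lemma axisConst_mul_axisParam_sub {x : ℂ} (hx : axisConst p q - x ≠ 0) :
    axisConst p q * (axisParam p q x - p) = x * (axisParam p q x - q) := by
  rw [axisParam_sub_left hx, axisParam_sub_right hx]
  ring

lemma eq_axisParam (hpq : p ≠ q) {x z : ℂ}
    (h : axisConst p q * (z - p) = x * (z - q)) :
    axisConst p q - x ≠ 0 ∧ z = axisParam p q x := by
  have hx : axisConst p q - x ≠ 0 := by
    intro h0
    rw [sub_eq_zero.1 h0] at h
    have hx0 : x ≠ 0 := by
      rw [← sub_eq_zero.1 h0]
      exact axisConst_ne_zero hpq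
    have := mul_left_cancel₀ hx0 h
    exact hpq (Circle.ext (sub_right_injective this))
  refine ⟨hx, ?_⟩
  rw [axisParam, eq_div_iff hx]
  linear_combination h

lemma axisJac_mul {x : ℂ} (hpq : p ≠ q) (hx : axisConst p q - x ≠ 0) :
    axisJac p q x * (axisParam p q x - q) ^ 2 = axisConst p q * axisParam p q x := by
  have h1 := axisConst_ne_zero hpq
  have h2 := sub_ne_zero_of_circle_ne hpq
  rw [axisParam_sub_right hx, axisJac, axisParam]
  field_simp

lemma norm_axisJac_ge (hpq : p ≠ q) {x : ℂ} (hx : ‖x‖ ≤ 1 / 2) : 1 / 16 ≤ ‖axisJac p q x‖ := by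
  have h0 : 0 < ‖(p : ℂ) - q‖ := norm_pos_iff.2 (sub_ne_zero_of_circle_ne hpq)
  have h1 : ‖(p : ℂ) - q‖ ≤ 2 := by
    refine (norm_sub_le _ _).trans ?_
    rw [Circle.norm_coe, Circle.norm_coe]
    norm_num
  have h2 : 1 / 2 ≤ ‖axisConst p q - x‖ := by
    have := norm_sub_norm_le (axisConst p q) x
    rw [norm_axisConst hpq] at this
    linarith
  have h3 : 1 / 2 ≤ ‖axisConst p q * p - q * x‖ := by
    have := norm_sub_norm_le (axisConst p q * p) (q * x)
    rw [norm_mul, norm_mul, norm_axisConst hpq, Circle.norm_coe, Circle.norm_coe] at this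
    linarith
  rw [axisJac, norm_div, norm_mul, norm_mul, norm_pow, norm_axisConst hpq, one_mul,
    le_div_iff₀ (by positivity)]
  nlinarith

lemma norm_axisJac_le (hpq : p ≠ q) {x : ℂ} (hx : ‖x‖ ≤ 1) :
    ‖axisJac p q x‖ ≤ 4 / ‖(p : ℂ) - q‖ ^ 2 := by
  have h0 : 0 < ‖(p : ℂ) - q‖ := norm_pos_iff.2 (sub_ne_zero_of_circle_ne hpq)
  have h2 : ‖axisConst p q - x‖ ≤ 2 := by
    have := norm_sub_le (axisConst p q) x
    rw [norm_axisConst hpq] at this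
    linarith
  have h3 : ‖axisConst p q * p - q * x‖ ≤ 2 := by
    have := norm_sub_le (axisConst p q * p) (q * x)
    rw [norm_mul, norm_mul, norm_axisConst hpq, Circle.norm_coe, Circle.norm_coe] at this
    linarith
  rw [axisJac, norm_div, norm_mul, norm_mul, norm_pow, norm_axisConst hpq, one_mul]
  gcongr
  nlinarith [norm_nonneg (axisConst p q - x), norm_nonneg (axisConst p q * p - q * x)]

lemma analyticAt_axisParam (hpq : p ≠ q) {x : ℂ} (hx : ‖x‖ < 1) :
    AnalyticAt ℂ (axisParam p q) x := by
  unfold axisParam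
  exact AnalyticAt.div (by fun_prop) (by fun_prop) (axisConst_sub_ne_zero hpq hx)

lemma analyticAt_axisJac (x : ℂ) : AnalyticAt ℂ (axisJac p q) x := by
  have : axisJac p q = fun x => (axisConst p q * p - q * x) * (axisConst p q - x) *
      (axisConst p q * ((p : ℂ) - q) ^ 2)⁻¹ := by
    funext x
    rw [axisJac, div_eq_mul_inv]
  rw [this]
  fun_prop

lemma analyticAt_localForm (m : ℕ) (hpq : p ≠ q) {F : ℂ → ℂ} {x : ℂ} (hx : ‖x‖ < 1)
    (hF : AnalyticAt ℂ F (axisParam p q x)) : AnalyticAt ℂ (localForm m p q F) x :=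
  (hF.comp (analyticAt_axisParam hpq hx)).mul ((analyticAt_axisJac x).pow m)

lemma analyticAt_localForm_zero (m : ℕ) (hpq : p ≠ q) {F : ℂ → ℂ} (hF : AnalyticAt ℂ F p) :
    AnalyticAt ℂ (localForm m p q F) 0 :=
  analyticAt_localForm m hpq (by simp) (by rwa [axisParam_zero hpq])

end AxisCoordinate

/-! ### Taylor coefficients -/

section TaylorCoefficients

/-- The `n`-th Taylor coefficient at `0`. -/
def taylorCoeff (n : ℕ) (f : ℂ → ℂ) : ℂ := iteratedDeriv n f 0 / n.factorial

lemma taylorCoeff_congr {f g : ℂ → ℂ} (h : f =ᶠ[𝓝 0] g) (n : ℕ) :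
    taylorCoeff n f = taylorCoeff n g := by
  rw [taylorCoeff, taylorCoeff, h.iteratedDeriv_eq n]

lemma taylorCoeff_add {f g : ℂ → ℂ} (hf : AnalyticAt ℂ f 0) (hg : AnalyticAt ℂ g 0) (n : ℕ) :
    taylorCoeff n (fun x => f x + g x) = taylorCoeff n f + taylorCoeff n g := by
  rw [taylorCoeff, iteratedDeriv_fun_add hf.contDiffAt hg.contDiffAt, add_div]
  rfl

lemma taylorCoeff_sub {f g : ℂ → ℂ} (hf : AnalyticAt ℂ f 0) (hg : AnalyticAt ℂ g 0) (n : ℕ) :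
    taylorCoeff n (fun x => f x - g x) = taylorCoeff n f - taylorCoeff n g := by
  rw [taylorCoeff, iteratedDeriv_fun_sub hf.contDiffAt hg.contDiffAt, sub_div]
  rfl

lemma taylorCoeff_const_mul (c : ℂ) (f : ℂ → ℂ) (n : ℕ) :
    taylorCoeff n (fun x => c * f x) = c * taylorCoeff n f := by
  rw [taylorCoeff, iteratedDeriv_const_mul_field, mul_div_assoc]
  rfl

lemma taylorCoeff_comp_mul (c : ℂ) (f : ℂ → ℂ) (n : ℕ) :
    taylorCoeff n (fun x => f (c * x)) = c ^ n * taylorCoeff n f := by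
  have h : ∀ n : ℕ, iteratedDeriv n (fun x => f (c * x)) =
      fun x => c ^ n * iteratedDeriv n f (c * x) := by
    intro n
    induction n with
    | zero => simp
    | succ n ih =>
      funext x
      rw [iteratedDeriv_succ, ih, deriv_const_mul_field,
        deriv_comp_mul_left c (iteratedDeriv n f), iteratedDeriv_succ, pow_succ]
      simp [mul_assoc]
  rw [taylorCoeff, h, taylorCoeff, ← mul_div_assoc]
  simp only [mul_zero]

lemma taylorCoeff_pow (n k : ℕ) :
    taylorCoeff n (fun x : ℂ => x ^ k) = if n = k then 1 else 0 := by
  rw [taylorCoeff, iteratedDeriv_fun_pow_zero]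
  split_ifs with h
  · subst h
    simp [Nat.factorial_ne_zero]
  · simp

lemma norm_taylorCoeff_le {f : ℂ → ℂ} {R M : ℝ} (hR : 0 < R)
    (hf : ∀ x, ‖x‖ < R → AnalyticAt ℂ f x) (hM : ∀ x, ‖x‖ < R → ‖f x‖ ≤ M) (n : ℕ) :
    ‖taylorCoeff n f‖ ≤ M * (2 / R) ^ n := by
  have hd : DifferentiableOn ℂ f (closure (Metric.ball 0 (R / 2))) := by
    intro x hx
    rw [closure_ball _ (by positivity)] at hx
    have : ‖x‖ < R := (mem_closedBall_zero_iff.1 hx).trans_lt (by linarith)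
    exact (hf x this).differentiableAt.differentiableWithinAt
  have := Complex.norm_iteratedDeriv_le_of_forall_mem_sphere_norm_le n (half_pos hR)
    hd.diffContOnCl (fun z hz => hM z (by rw [mem_sphere_zero_iff_norm.1 hz]; linarith))
  have hfac : (0 : ℝ) < n.factorial := by exact_mod_cast n.factorial_pos
  rw [taylorCoeff, norm_div, Complex.norm_natCast, div_le_iff₀ hfac]
  refine this.trans_eq ?_
  rw [div_pow, div_pow]
  field_simp

lemma hasSum_taylorCoeff {f : ℂ → ℂ} {R : ℝ} (hf : ∀ x, ‖x‖ < R → AnalyticAt ℂ f x) {x : ℂ}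
    (hx : ‖x‖ < R) : HasSum (fun n => taylorCoeff n f * x ^ n) (f x) := by
  have hd : DifferentiableOn ℂ f (Metric.ball 0 R) := fun y hy =>
    (hf y (mem_ball_zero_iff.1 hy)).differentiableAt.differentiableWithinAt
  have := Complex.hasSum_taylorSeries_on_ball hd (mem_ball_zero_iff.2 hx)
  convert! this using 2 with n
  simp only [taylorCoeff, sub_zero, smul_eq_mul]
  ring

/-- The remainder of the Taylor polynomial, for an argument well inside of the disc. -/
lemma norm_sub_taylor_le {f : ℂ → ℂ} {R M : ℝ} (hR : 0 < R)
    (hf : ∀ x, ‖x‖ < R → AnalyticAt ℂ f x) (hM : ∀ x, ‖x‖ < R → ‖f x‖ ≤ M) (N : ℕ) {x : ℂ}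
    (hx : ‖x‖ ≤ R / 4) :
    ‖f x - ∑ n ∈ Finset.range N, taylorCoeff n f * x ^ n‖ ≤ 2 * M * (1 / 2) ^ N := by
  have hM0 : 0 ≤ M := (norm_nonneg _).trans (hM 0 (by simpa using hR))
  have h1 : ∀ n, ‖taylorCoeff n f * x ^ n‖ ≤ M * (1 / 2) ^ n := by
    intro n
    rw [norm_mul, norm_pow]
    calc _ ≤ M * (2 / R) ^ n * (R / 4) ^ n := by
          gcongr
          exact norm_taylorCoeff_le hR hf hM n
      _ = M * (1 / 2) ^ n := by
          rw [mul_assoc, ← mul_pow]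
          congr 2
          field_simp
          norm_num
  have h2 := norm_sub_le_of_geometric_bound_of_hasSum (by norm_num) h1
    (hasSum_taylorCoeff hf (hx.trans_lt (by linarith))) N
  rw [norm_sub_rev]
  refine h2.trans_eq ?_
  ring

end TaylorCoefficients

/-! ### Taylor coefficients of analytic sections -/

section Germs

/-- Two holomorphic extensions of a function on the circle have the same germs. -/
lemma eventuallyEq_of_eq_on_circle {F G : ℂ → ℂ} {p : Circle} (hF : AnalyticAt ℂ F p)
    (hG : AnalyticAt ℂ G p) (h : ∀ z : Circle, F z = G z) : F =ᶠ[𝓝 (p : ℂ)] G := by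
  rw [Filter.EventuallyEq, ← hF.frequently_eq_iff_eventually_eq hG]
  have hd : HasDerivAt (fun t : ℝ => (p : ℂ) * Complex.exp (t * Complex.I)) (p * Complex.I) 0 := by
    have h1 : HasDerivAt (fun t : ℝ => (t : ℂ) * Complex.I) Complex.I 0 := by
      simpa using (Complex.ofRealCLM.hasDerivAt (x := (0 : ℝ))).mul_const Complex.I
    have h2 := (h1.cexp).const_mul (p : ℂ)
    simpa using h2
  have ht := hd.tendsto_nhdsNE (mul_ne_zero (Circle.coe_ne_zero p) Complex.I_ne_zero)
  simp only [Complex.ofReal_zero, zero_mul, Complex.exp_zero, mul_one] at ht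
  refine ht.frequently (Filter.Eventually.frequently (Filter.Eventually.of_forall fun t => ?_))
  have := h (p * Circle.exp t)
  simpa using this

variable {p q : Circle}

lemma localForm_congr (m : ℕ) (hpq : p ≠ q) {F G : ℂ → ℂ} (h : F =ᶠ[𝓝 (p : ℂ)] G) :
    localForm m p q F =ᶠ[𝓝 0] localForm m p q G := by
  have h1 := (analyticAt_axisParam hpq (x := 0) (by simp)).continuousAt
  have h2 : Filter.Tendsto (axisParam p q) (𝓝 0) (𝓝 (p : ℂ)) := by
    have := h1.tendsto
    rwa [axisParam_zero hpq] at this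
  filter_upwards [h2.eventually h] with x hx
  rw [localForm, localForm, hx]

/-- A holomorphic extension of a real analytic function on the circle. -/
def extension (φ : Analytic) : ℂ → ℂ := φ.2.choose

lemma extension_analyticAt (φ : Analytic) (p : Circle) : AnalyticAt ℂ (extension φ) p :=
  φ.2.choose_spec.1 _ (mem_sphere_zero_iff_norm.2 (Circle.norm_coe p))

lemma extension_apply (φ : Analytic) (z : Circle) : extension φ z = φ.1 z :=
  φ.2.choose_spec.2 z

/-- The Taylor coefficient in `p` of a holomorphic extension of a section of `T ^ m`, with respect
to the coordinate centred at `p` and its vector field. -/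
def coeffAt (m : ℕ) (p q : Circle) (n : ℕ) (φ : Analytic) : ℂ :=
  taylorCoeff n (localForm m p q (extension φ))

lemma coeffAt_eq (m : ℕ) (hpq : p ≠ q) (n : ℕ) {φ : Analytic} {F : ℂ → ℂ}
    (hF : AnalyticAt ℂ F p) (hφ : ∀ z : Circle, F z = φ.1 z) :
    coeffAt m p q n φ = taylorCoeff n (localForm m p q F) :=
  taylorCoeff_congr (localForm_congr m hpq (eventuallyEq_of_eq_on_circle
    (extension_analyticAt φ p) hF (fun z => by rw [extension_apply, hφ]))) n

lemma coeffAt_add (m : ℕ) (hpq : p ≠ q) (n : ℕ) (φ ψ : Analytic) :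
    coeffAt m p q n (φ + ψ) = coeffAt m p q n φ + coeffAt m p q n ψ := by
  rw [coeffAt_eq m hpq n (φ := φ + ψ) (F := fun z => extension φ z + extension ψ z)
    ((extension_analyticAt φ p).add (extension_analyticAt ψ p))
    (fun z => by rw [extension_apply, extension_apply]; rfl), coeffAt, coeffAt,
    ← taylorCoeff_add (analyticAt_localForm_zero m hpq (extension_analyticAt φ p))
      (analyticAt_localForm_zero m hpq (extension_analyticAt ψ p))]
  congr 1
  funext x
  simp only [localForm, add_mul]

lemma coeffAt_smul (m : ℕ) (hpq : p ≠ q) (n : ℕ) (c : ℂ) (φ : Analytic) :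
    coeffAt m p q n (c • φ) = c * coeffAt m p q n φ := by
  rw [coeffAt_eq m hpq n (φ := c • φ) (F := fun z => c * extension φ z)
    (analyticAt_const.mul (extension_analyticAt φ p))
    (fun z => by rw [extension_apply]; rfl), coeffAt, ← taylorCoeff_const_mul]
  congr 1
  funext x
  simp only [localForm, mul_assoc]

/-- An element that fixes `p` and `q` multiplies the coordinate by `(den g q) ^ 2`. -/
lemma mob_axisParam (hpq : p ≠ q) {g : SL(2, ℝ)} (hp : mob g p = p) (hq : mob g q = q) {x : ℂ}
    (hx : axisConst p q - x ≠ 0) (hd : den g (axisParam p q x) ≠ 0) :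
    axisConst p q - den g q ^ 2 * x ≠ 0 ∧
      mob g (axisParam p q x) = axisParam p q (den g q ^ 2 * x) := by
  have hdp := den_ne_zero g (Circle.norm_coe p).le
  have hdq := den_ne_zero g (Circle.norm_coe q).le
  have h1 := mob_sub_mob g hd hdp
  have h2 := mob_sub_mob g hd hdq
  rw [hp] at h1
  rw [hq] at h2
  have h3 := den_mul_den hpq hp hq
  have h4 := axisConst_mul_axisParam_sub hx
  apply eq_axisParam hpq
  rw [h1, h2, ← mul_div_assoc, h4, div_eq_iff (mul_ne_zero hd hdp), ← mul_div_assoc,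
    div_mul_eq_mul_div, eq_div_iff (mul_ne_zero hd hdq)]
  linear_combination -(x * (axisParam p q x - q) * den g (axisParam p q x) * den g q) * h3

lemma axisJac_mul_den (hpq : p ≠ q) {g : SL(2, ℝ)} (hp : mob g p = p) (hq : mob g q = q) {x : ℂ}
    (hx : axisConst p q - x ≠ 0) (hx0 : axisParam p q x ≠ 0)
    (hd : den g (axisParam p q x) ≠ 0) :
    axisJac p q (den g q ^ 2 * x) = den g q ^ 2 *
      (den g (axisParam p q x) * (suB g * (axisParam p q x)⁻¹ + suA g)) * axisJac p q x := by
  have hdq := den_ne_zero g (Circle.norm_coe q).le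
  obtain ⟨h1, h2⟩ := mob_axisParam hpq hp hq hx hd
  have h3 := axisJac_mul hpq h1
  have h4 := axisJac_mul hpq hx
  have h5 := mob_sub_mob g hd hdq
  have h6 := axisParam_sub_right_ne_zero hpq hx
  rw [hq] at h5
  rw [← h2, h5] at h3
  have h7 : mob g (axisParam p q x) * den g (axisParam p q x) =
      axisParam p q x * (suB g * (axisParam p q x)⁻¹ + suA g) := by
    rw [mob, div_mul_cancel₀ _ hd]
    field_simp
    ring
  set z := axisParam p q x
  set w := mob g z
  set d := den g z
  set e := den g q
  set k := suB g * z⁻¹ + suA g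
  rw [div_pow, ← mul_div_assoc, div_eq_iff (pow_ne_zero 2 (mul_ne_zero hd hdq))] at h3
  apply mul_right_cancel₀ (pow_ne_zero 2 h6)
  linear_combination h3 + e ^ 2 * d * axisConst p q * h7 - e ^ 2 * d * k * h4

/-- Elements that fix `p` and `q` act on the Taylor coefficients at `p` by scalars. -/
lemma coeffAt_sectionRep (m : ℕ) (hpq : p ≠ q) {g : SL(2, ℝ)} (hp : mob g p = p)
    (hq : mob g q = q) (n : ℕ) (φ : Analytic) :
    coeffAt m p q n (sectionRep m g⁻¹ φ) =
      (den g q ^ 2) ^ n / (den g q ^ 2) ^ m * coeffAt m p q n φ := by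
  have hdq := den_ne_zero g (Circle.norm_coe q).le
  have hF : AnalyticAt ℂ (fun z => weightExt m g z * extension φ (mob g z)) p :=
    analyticAt_transform m g _ (Circle.norm_coe p) (by rw [hp]; exact extension_analyticAt φ p)
  rw [coeffAt_eq m hpq n hF (fun z => by
    rw [sectionRep_apply, inv_inv, weightExt_eq, ← coe_circleAct, extension_apply])]
  have hev : localForm m p q (fun z => weightExt m g z * extension φ (mob g z)) =ᶠ[𝓝 0]
      fun x => ((den g q ^ 2) ^ m)⁻¹ * localForm m p q (extension φ) (den g q ^ 2 * x) := by
    have h1 := (analyticAt_axisParam hpq (x := 0) (by simp)).continuousAt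
    have h2 : ContinuousAt (fun x => den g (axisParam p q x)) 0 := by
      unfold den
      fun_prop
    have h3 : den g (axisParam p q 0) ≠ 0 := by
      rw [axisParam_zero hpq]
      exact den_ne_zero g (Circle.norm_coe p).le
    filter_upwards [h2.eventually_ne h3, Metric.ball_mem_nhds (0 : ℂ) one_pos] with x hd hx
    rw [mem_ball_zero_iff] at hx
    have hx1 := axisConst_sub_ne_zero hpq hx
    rw [localForm, localForm, ← (mob_axisParam hpq hp hq hx1 hd).2,
      axisJac_mul_den hpq hp hq hx1 (axisParam_ne_zero hpq hx) hd, weightExt, Complex.cpow_natCast]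
    simp only [mul_pow]
    have h5 := pow_ne_zero m (pow_ne_zero 2 hdq)
    field_simp
  rw [taylorCoeff_congr hev, taylorCoeff_const_mul,
    taylorCoeff_comp_mul (den g q ^ 2) (localForm m p q (extension φ)), coeffAt]
  ring

end Germs

/-! ### Sections that approximate a monomial at one point and vanish at the other -/

section CutoffMonomials

variable {p q : Circle}

/-- In the coordinate `x` centred at `p` and up to the change of trivialization, this is the section
`x ^ n / (1 + x ^ (2 (j + n + 1)))` of `T ^ m`. On the circle `x` is real, so that it is analytic
there. As `j` tends to infinity it approaches `x ^ n` near `p` and `0` near `q`. -/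
def cutoffExt (m : ℕ) (p q : Circle) (n j : ℕ) (z : ℂ) : ℂ :=
  (axisConst p q * (z - p)) ^ n * (z - q) ^ (2 * j + n + 2) /
    ((axisConst p q * (z - p)) ^ (2 * (j + n + 1)) + (z - q) ^ (2 * (j + n + 1))) *
    ((z - q) ^ 2 / (axisConst p q * z)) ^ m

lemma analyticAt_cutoffExt (m : ℕ) (hpq : p ≠ q) (n j : ℕ) {z : ℂ} (hz : z ≠ 0)
    (hd : (axisConst p q * (z - p)) ^ (2 * (j + n + 1)) + (z - q) ^ (2 * (j + n + 1)) ≠ 0) :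
    AnalyticAt ℂ (cutoffExt m p q n j) z := by
  unfold cutoffExt
  refine AnalyticAt.mul (AnalyticAt.div (by fun_prop) (by fun_prop) hd) ?_
  exact (AnalyticAt.div (by fun_prop) (by fun_prop)
    (mul_ne_zero (axisConst_ne_zero hpq) hz)).pow m

lemma cutoffDen_ne_zero_of_norm_ne (hpq : p ≠ q) (k : ℕ) {z : ℂ} (h : ‖z - p‖ ≠ ‖z - q‖) :
    (axisConst p q * (z - p)) ^ (2 * (k + 1)) + (z - q) ^ (2 * (k + 1)) ≠ 0 := by
  intro h0
  apply h
  have h1 := congrArg norm (eq_neg_of_add_eq_zero_left h0)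
  rw [norm_neg, norm_pow, norm_pow, norm_mul, norm_axisConst hpq, one_mul] at h1
  exact (pow_left_inj₀ (norm_nonneg _) (norm_nonneg _) (by omega)).1 h1

/-- The coordinate is real on the circle. -/
lemma star_axisConst_mul_sub (z : Circle) :
    star (axisConst p q * ((z : ℂ) - p) * star ((z : ℂ) - q)) =
      axisConst p q * ((z : ℂ) - p) * star ((z : ℂ) - q) := by
  have h1 := star_axisConst_mul (p := p) (q := q)
  have hz := circle_mul_star z
  have hp := circle_mul_star p
  have hq := circle_mul_star q
  have h2 : star (axisConst p q) = axisConst p q * p * star (q : ℂ) := by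
    rw [← h1]
    linear_combination -(star (axisConst p q)) * hq
  rw [star_mul', star_mul', star_star, h2, star_sub, star_sub]
  linear_combination (axisConst p q * star (q : ℂ) * (q - z)) * hp +
    axisConst p q * (1 - p * star (z : ℂ)) * hq +
    (axisConst p q * (p * star (q : ℂ) - 1 )) * hz

lemma cutoffDen_ne_zero_circle (hpq : p ≠ q) (k : ℕ) (z : Circle) :
    (axisConst p q * ((z : ℂ) - p)) ^ (2 * (k + 1)) + ((z : ℂ) - q) ^ (2 * (k + 1)) ≠ 0 := by
  intro h0
  obtain ⟨x, hx⟩ : ∃ x : ℝ, (x : ℂ) = axisConst p q * ((z : ℂ) - p) * star ((z : ℂ) - q) :=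
    ⟨_, Complex.conj_eq_iff_re.1 (star_axisConst_mul_sub z)⟩
  have hy : ((‖(z : ℂ) - q‖ ^ 2 : ℝ) : ℂ) = ((z : ℂ) - q) * star ((z : ℂ) - q) := by
    simpa using (Complex.mul_conj' ((z : ℂ) - q)).symm
  have h1 : ((x ^ (2 * (k + 1)) + (‖(z : ℂ) - q‖ ^ 2) ^ (2 * (k + 1)) : ℝ) : ℂ) = 0 := by
    rw [Complex.ofReal_add, Complex.ofReal_pow, Complex.ofReal_pow, hx, hy, mul_pow _ (star _),
      mul_pow _ (star _), ← add_mul, h0, zero_mul]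
  have h2 : x ^ (2 * (k + 1)) + (‖(z : ℂ) - q‖ ^ 2) ^ (2 * (k + 1)) = 0 := by exact_mod_cast h1
  have h3 : 0 ≤ x ^ (2 * (k + 1)) := (even_two_mul _).pow_nonneg x
  have h4 : 0 ≤ (‖(z : ℂ) - q‖ ^ 2) ^ (2 * (k + 1)) := by positivity
  have h5 : (‖(z : ℂ) - q‖ ^ 2) ^ (2 * (k + 1)) = 0 := by linarith
  have h6 : (z : ℂ) - q = 0 := norm_eq_zero.1 (pow_eq_zero_iff (by omega) |>.1
    (pow_eq_zero_iff (by omega) |>.1 h5))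
  rw [h6, zero_pow (by omega), add_zero] at h0
  have h7 := pow_eq_zero_iff (by omega) |>.1 h0
  have h8 := (mul_eq_zero.1 h7).resolve_left (axisConst_ne_zero hpq)
  exact hpq (Circle.ext ((sub_eq_zero.1 h8).symm.trans (sub_eq_zero.1 h6)))

lemma analyticAt_cutoffExt_circle (m : ℕ) (hpq : p ≠ q) (n j : ℕ) (z : Circle) :
    AnalyticAt ℂ (cutoffExt m p q n j) z :=
  analyticAt_cutoffExt m hpq n j (Circle.coe_ne_zero z)
    (cutoffDen_ne_zero_circle hpq (j + n) z)

/-- The section with extension `cutoffExt`. -/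
def cutoff (m : ℕ) (hpq : p ≠ q) (n j : ℕ) : Analytic :=
  ⟨fun z => cutoffExt m p q n j z, cutoffExt m p q n j, fun z hz =>
    analyticAt_cutoffExt_circle m hpq n j ⟨z, hz⟩, fun _ => rfl⟩

lemma one_add_pow_ne_zero {x : ℂ} (hx : ‖x‖ < 1) (k : ℕ) : 1 + x ^ (2 * (k + 1)) ≠ 0 := by
  intro h
  have h1 := congrArg norm (eq_neg_of_add_eq_zero_right h)
  rw [norm_neg, norm_pow, norm_one] at h1
  have := pow_lt_one₀ (norm_nonneg x) hx (n := 2 * (k + 1)) (by omega)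
  linarith

lemma localForm_cutoff_left (m : ℕ) (hpq : p ≠ q) (n j : ℕ) {x : ℂ} (hx : ‖x‖ < 1) :
    localForm m p q (cutoffExt m p q n j) x = x ^ n / (1 + x ^ (2 * (j + n + 1))) := by
  have hc := axisConst_sub_ne_zero hpq hx
  have h1 := axisConst_mul_axisParam_sub hc
  have h2 := axisJac_mul hpq hc
  have h3 := axisParam_sub_right_ne_zero hpq hc
  have h4 := axisParam_ne_zero hpq hx
  have h5 := axisConst_ne_zero hpq
  have h6 := one_add_pow_ne_zero hx (j + n)
  have hm : ((axisParam p q x - q) ^ 2 / (axisConst p q * axisParam p q x)) ^ m *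
      axisJac p q x ^ m = 1 := by
    rw [← mul_pow, div_mul_eq_mul_div, div_eq_one_iff_eq (mul_ne_zero h5 h4) |>.2, one_pow]
    rw [← h2, mul_comm]
  rw [localForm, cutoffExt, h1, mul_assoc, hm, mul_one]
  generalize axisParam p q x - q = Q at h3
  have h7 : (x * Q) ^ n * Q ^ (2 * j + n + 2) = x ^ n * Q ^ (2 * (j + n + 1)) := by ring
  have h8 : (x * Q) ^ (2 * (j + n + 1)) + Q ^ (2 * (j + n + 1)) =
      (1 + x ^ (2 * (j + n + 1))) * Q ^ (2 * (j + n + 1)) := by ring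
  rw [h7, h8, mul_div_mul_right _ _ (pow_ne_zero _ h3)]

lemma localForm_cutoff_right (m : ℕ) (hpq : p ≠ q) (n j : ℕ) {y : ℂ} (hy : ‖y‖ < 1) :
    localForm m q p (cutoffExt m p q n j) y =
      (-1) ^ (n + m) * y ^ (2 * j + n + 2 + 2 * m) / (1 + y ^ (2 * (j + n + 1))) := by
  have hc := axisConst_sub_ne_zero hpq.symm hy
  have h1 := axisConst_mul_axisParam_sub hc
  have h2 := axisJac_mul hpq.symm hc
  have h3 := axisParam_sub_right_ne_zero hpq.symm hc
  have h4 := axisParam_ne_zero hpq.symm hy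
  have h5 := axisConst_ne_zero hpq
  have h6 := one_add_pow_ne_zero hy (j + n)
  have h9 := axisConst_mul_swap hpq
  rw [localForm, cutoffExt]
  set z := axisParam q p y
  set c := axisConst p q
  set X := c * (z - p)
  have hX : X ≠ 0 := mul_ne_zero h5 h3
  have hQ : z - q = -y * X := by
    linear_combination -(c : ℂ) * h1 + (z - q) * h9
  have hJ : axisJac q p y * X ^ 2 = -c * z := by
    linear_combination c ^ 2 * h2 + c * z * h9
  have hm : ((-y * X) ^ 2 / (c * z)) ^ m * axisJac q p y ^ m = (-1) ^ m * y ^ (2 * m) := by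
    rw [← mul_pow, pow_mul, ← mul_pow]
    congr 1
    rw [div_mul_eq_mul_div, div_eq_iff (mul_ne_zero h5 h4)]
    linear_combination y ^ 2 * hJ
  rw [hQ, mul_assoc, hm]
  clear_value X
  have h7 : X ^ n * (-y * X) ^ (2 * j + n + 2) =
      (-1) ^ n * y ^ (2 * j + n + 2) * X ^ (2 * (j + n + 1)) := by
    rw [neg_mul, neg_pow, show 2 * j + n + 2 = n + 2 * (j + 1) by ring, pow_add (-1 : ℂ) n, pow_mul,
      neg_one_sq, one_pow]
    ring
  have h8 : X ^ (2 * (j + n + 1)) + (-y * X) ^ (2 * (j + n + 1)) =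
      (1 + y ^ (2 * (j + n + 1))) * X ^ (2 * (j + n + 1)) := by
    rw [neg_mul, (even_two_mul _).neg_pow]
    ring
  rw [h7, h8, mul_div_mul_right _ _ (pow_ne_zero _ hX)]
  ring

lemma half_le_norm_one_add_pow {x : ℂ} (hx : ‖x‖ ≤ 1 / 2) (k : ℕ) :
    1 / 2 ≤ ‖1 + x ^ (2 * (k + 1))‖ := by
  have h1 : ‖x ^ (2 * (k + 1))‖ ≤ 1 / 2 := by
    rw [norm_pow]
    calc ‖x‖ ^ (2 * (k + 1)) ≤ ‖x‖ ^ 1 :=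
          pow_le_pow_of_le_one (norm_nonneg x) (by linarith) (by omega)
      _ ≤ 1 / 2 := by rwa [pow_one]
  have h2 := norm_sub_le (1 + x ^ (2 * (k + 1))) (x ^ (2 * (k + 1)))
  rw [add_sub_cancel_right, norm_one] at h2
  linarith

lemma norm_pow_div_le {x : ℂ} {r : ℝ} (hx : ‖x‖ ≤ r) (hr : r ≤ 1 / 2) (k : ℕ) {i l : ℕ}
    (hil : i ≤ l) : ‖x ^ l / (1 + x ^ (2 * (k + 1)))‖ ≤ 2 * r ^ i := by
  have hr0 : 0 ≤ r := (norm_nonneg x).trans hx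
  have h1 := half_le_norm_one_add_pow (hx.trans hr) k
  rw [norm_div, norm_pow, div_le_iff₀ (by linarith)]
  have h2 : ‖x‖ ^ l ≤ r ^ i :=
    (pow_le_pow_left₀ (norm_nonneg x) hx l).trans
      (pow_le_pow_of_le_one hr0 (by linarith) hil)
  have h3 : 0 ≤ r ^ i := by positivity
  nlinarith

lemma norm_localForm_cutoff_left_sub_le (m : ℕ) (hpq : p ≠ q) (n j : ℕ) {x : ℂ} {r : ℝ}
    (hx : ‖x‖ ≤ r) (hr : r ≤ 1 / 2) :
    ‖localForm m p q (cutoffExt m p q n j) x - x ^ n‖ ≤ 2 * r ^ j := by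
  have h6 := one_add_pow_ne_zero (x := x) (by linarith) (j + n)
  rw [localForm_cutoff_left m hpq n j (by linarith), div_sub' h6, ← norm_neg, ← neg_div]
  have : -(x ^ n - (1 + x ^ (2 * (j + n + 1))) * x ^ n) = x ^ (n + 2 * (j + n + 1)) := by ring
  rw [this]
  exact norm_pow_div_le hx hr _ (by omega)

lemma norm_localForm_cutoff_left_le (m : ℕ) (hpq : p ≠ q) (n j : ℕ) {x : ℂ} {r : ℝ}
    (hx : ‖x‖ ≤ r) (hr : r ≤ 1 / 2) :
    ‖localForm m p q (cutoffExt m p q n j) x‖ ≤ 2 * r ^ n := by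
  rw [localForm_cutoff_left m hpq n j (by linarith)]
  exact norm_pow_div_le hx hr _ le_rfl

lemma norm_localForm_cutoff_right_le (m : ℕ) (hpq : p ≠ q) (n j : ℕ) {y : ℂ} {r : ℝ}
    (hy : ‖y‖ ≤ r) (hr : r ≤ 1 / 2) {i : ℕ} (hi : i ≤ 2 * j + n + 2 + 2 * m) :
    ‖localForm m q p (cutoffExt m p q n j) y‖ ≤ 2 * r ^ i := by
  rw [localForm_cutoff_right m hpq n j (by linarith), mul_div_assoc, norm_mul, norm_pow, norm_neg,
    norm_one, one_pow, one_mul]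
  exact norm_pow_div_le hy hr _ hi

end CutoffMonomials

/-! ### Moments of functionals carried by two points -/

section LocalBounds

variable {p q : Circle}

/-- The union of the discs of radius `r` about `p` and `q` in the respective coordinates. -/
def axisNhd (p q : Circle) (r : ℝ) : Set ℂ :=
  {z | ‖z - p‖ < r * ‖z - q‖ ∨ ‖z - q‖ < r * ‖z - p‖}

lemma isOpen_axisNhd (p q : Circle) (r : ℝ) : IsOpen (axisNhd p q r) :=
  IsOpen.union (s₁ := {z : ℂ | ‖z - p‖ < r * ‖z - q‖}) (s₂ := {z : ℂ | ‖z - q‖ < r * ‖z - p‖})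
    (isOpen_lt (by fun_prop) (by fun_prop)) (isOpen_lt (by fun_prop) (by fun_prop))

lemma exists_axisParam_eq (hpq : p ≠ q) {z : ℂ} {r : ℝ} (h : ‖z - p‖ < r * ‖z - q‖) :
    ∃ x : ℂ, ‖x‖ < r ∧ z = axisParam p q x := by
  have hzq : z - q ≠ 0 := by
    intro h0
    rw [h0, norm_zero, mul_zero] at h
    exact absurd h (not_lt.2 (norm_nonneg _))
  refine ⟨axisConst p q * (z - p) / (z - q), ?_, ?_⟩
  · rw [norm_div, norm_mul, norm_axisConst hpq, one_mul, div_lt_iff₀ (norm_pos_iff.2 hzq)]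
    exact h
  · exact (eq_axisParam hpq (by rw [div_mul_cancel₀ _ hzq])).2

lemma norm_axisParam_sub (hpq : p ≠ q) {x : ℂ} (hx : ‖x‖ < 1) :
    ‖axisParam p q x - p‖ = ‖x‖ * ‖axisParam p q x - q‖ := by
  have := congrArg norm (axisConst_mul_axisParam_sub (axisConst_sub_ne_zero hpq hx))
  rwa [norm_mul, norm_mul, norm_axisConst hpq, one_mul] at this

lemma axisParam_mem_axisNhd (hpq : p ≠ q) {x : ℂ} {r : ℝ} (hx : ‖x‖ < r) (hr : r ≤ 1) :
    axisParam p q x ∈ axisNhd p q r := by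
  have hx1 : ‖x‖ < 1 := by linarith
  left
  rw [norm_axisParam_sub hpq hx1]
  exact mul_lt_mul_of_pos_right hx
    (norm_pos_iff.2 (axisParam_sub_right_ne_zero hpq (axisConst_sub_ne_zero hpq hx1)))

lemma axisNhd_swap (p q : Circle) (r : ℝ) : axisNhd p q r = axisNhd q p r := by
  ext z
  exact or_comm

/-- Functionals carried by two points are bounded in terms of the local forms at these points. -/
lemma carried_bound (m : ℕ) (hpq : p ≠ q) {L : Module.Dual ℂ Analytic} (hL : L ∈ carried {p, q})
    {r : ℝ} (hr0 : 0 < r) (hr : r ≤ 1 / 2) : ∃ C : ℝ, 0 ≤ C ∧ ∀ (φ : Analytic) (F : ℂ → ℂ),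
      (∀ z ∈ axisNhd p q r, AnalyticAt ℂ F z) → (∀ z : Circle, AnalyticAt ℂ F z) →
      (∀ z : Circle, F z = φ.1 z) → ∀ M : ℝ, 0 ≤ M →
      (∀ x : ℂ, ‖x‖ < r → ‖localForm m p q F x‖ ≤ M ∧ ‖localForm m q p F x‖ ≤ M) →
      ‖L φ‖ ≤ C * M := by
  obtain ⟨C, hC⟩ := hL (axisNhd p q r) (isOpen_axisNhd p q r) (by
    have h := norm_pos_iff.2 (sub_ne_zero_of_circle_ne hpq)
    rintro t (rfl | rfl)
    · left
      rw [sub_self, norm_zero]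
      positivity
    · right
      rw [sub_self, norm_zero, norm_sub_rev]
      positivity)
  refine ⟨|C| * 16 ^ m, by positivity, fun φ F hF hF' hφ M hM hb => ?_⟩
  have key : ∀ {p q : Circle} (_ : p ≠ q) {x : ℂ} (_ : ‖x‖ < r) (_ : ‖localForm m p q F x‖ ≤ M),
      ‖F (axisParam p q x)‖ ≤ 16 ^ m * M := by
    intro p q hpq x hx h
    have h1 := norm_axisJac_ge hpq (hx.le.trans hr)
    rw [localForm, norm_mul, norm_pow] at h
    have h2 : (1 / 16) ^ m ≤ ‖axisJac p q x‖ ^ m := pow_le_pow_left₀ (by norm_num) h1 m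
    have h3 : ‖F (axisParam p q x)‖ * (1 / 16) ^ m ≤ M :=
      (mul_le_mul_of_nonneg_left h2 (norm_nonneg _)).trans h
    calc ‖F (axisParam p q x)‖ = 16 ^ m * (‖F (axisParam p q x)‖ * (1 / 16) ^ m) := by
          rw [mul_left_comm, ← mul_pow]
          norm_num
      _ ≤ 16 ^ m * M := by gcongr
  have := hC φ F (by
      rintro z (hz | hz)
      · exact hF z hz
      · exact hF' ⟨z, hz⟩) hφ (16 ^ m * M) (by positivity) (by
      rintro z (hz | hz)
      · obtain ⟨x, hx, rfl⟩ := exists_axisParam_eq hpq hz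
        exact key hpq hx (hb x hx).1
      · obtain ⟨x, hx, rfl⟩ := exists_axisParam_eq hpq.symm hz
        exact key hpq.symm hx (hb x hx).2)
  calc _ ≤ C * (16 ^ m * M) := this
    _ ≤ |C| * (16 ^ m * M) := by
        gcongr
        exact le_abs_self C
    _ = _ := by ring

lemma analyticAt_cutoffExt_axisNhd (m : ℕ) (hpq : p ≠ q) (n j : ℕ) {r : ℝ} (hr : r ≤ 1 / 2)
    {z : ℂ} (hz : z ∈ axisNhd p q r) : AnalyticAt ℂ (cutoffExt m p q n j) z := by
  apply analyticAt_cutoffExt m hpq n j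
  · rintro rfl
    rcases hz with hz | hz <;>
    · rw [zero_sub, zero_sub, norm_neg, norm_neg, Circle.norm_coe, Circle.norm_coe] at hz
      linarith
  · apply cutoffDen_ne_zero_of_norm_ne hpq (j + n)
    intro h
    rcases hz with hz | hz
    · rw [h] at hz
      nlinarith [norm_nonneg (z - q)]
    · rw [h] at hz
      nlinarith [norm_nonneg (z - q)]

/-- The sequences that decrease faster than every geometric progression. -/
def rapid : Submodule ℂ (ℕ → ℂ) where
  carrier := {c | ∀ ε : ℝ, 0 < ε → ∃ C : ℝ, ∀ n, ‖c n‖ ≤ C * ε ^ n}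
  add_mem' := by
    intro c d hc hd ε hε
    obtain ⟨C, hC⟩ := hc ε hε
    obtain ⟨D, hD⟩ := hd ε hε
    refine ⟨C + D, fun n => ?_⟩
    rw [add_mul]
    exact (norm_add_le _ _).trans (add_le_add (hC n) (hD n))
  zero_mem' := fun ε _ => ⟨0, fun n => by simp⟩
  smul_mem' := by
    intro a c hc ε hε
    obtain ⟨C, hC⟩ := hc ε hε
    refine ⟨‖a‖ * C, fun n => ?_⟩
    rw [Pi.smul_apply, norm_smul, mul_assoc]
    exact mul_le_mul_of_nonneg_left (hC n) (norm_nonneg a)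

/-- The value of a functional carried by `{p, q}` on the germ `x ^ n` at `p` (and `0` at `q`),
defined by approximation. -/
lemma exists_moments (m : ℕ) (hpq : p ≠ q) {L : Module.Dual ℂ Analytic}
    (hL : L ∈ carried {p, q}) : ∃ c ∈ rapid, ∀ n,
      Filter.Tendsto (fun j => L (cutoff m hpq n j)) Filter.atTop (𝓝 (c n)) := by
  have hlim : ∀ n, ∃ c, Filter.Tendsto (fun j => L (cutoff m hpq n j)) Filter.atTop (𝓝 c) := by
    intro n
    obtain ⟨C, hC0, hC⟩ := carried_bound m hpq hL (r := 1 / 2) (by norm_num) le_rfl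
    refine cauchySeq_tendsto_of_complete
      (cauchySeq_of_le_geometric (1 / 2) (C * 4) (by norm_num) fun j => ?_)
    rw [dist_eq_norm, ← map_sub, mul_assoc]
    refine hC _ (fun z => cutoffExt m p q n j z - cutoffExt m p q n (j + 1) z)
      (fun z hz => (analyticAt_cutoffExt_axisNhd m hpq n j le_rfl hz).sub
        (analyticAt_cutoffExt_axisNhd m hpq n (j + 1) le_rfl hz))
      (fun z => (analyticAt_cutoffExt_circle m hpq n j z).sub
        (analyticAt_cutoffExt_circle m hpq n (j + 1) z)) (fun z => rfl) _ (by positivity)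
      fun x hx => ?_
    have hj : ((1 : ℝ) / 2) ^ (j + 1) ≤ (1 / 2) ^ j :=
      pow_le_pow_of_le_one (by norm_num) (by norm_num) (by omega)
    constructor
    · have h1 := norm_localForm_cutoff_left_sub_le m hpq n j hx.le le_rfl
      have h2 := norm_localForm_cutoff_left_sub_le m hpq n (j + 1) hx.le le_rfl
      have h3 := norm_sub_le (localForm m p q (cutoffExt m p q n j) x - x ^ n)
        (localForm m p q (cutoffExt m p q n (j + 1)) x - x ^ n)
      rw [sub_sub_sub_cancel_right] at h3
      have h4 : localForm m p q (fun z => cutoffExt m p q n j z - cutoffExt m p q n (j + 1) z) x =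
          localForm m p q (cutoffExt m p q n j) x - localForm m p q (cutoffExt m p q n (j + 1)) x := by
        simp only [localForm, sub_mul]
      rw [h4]
      linarith
    · have h1 := norm_localForm_cutoff_right_le m hpq n j hx.le le_rfl (i := j) (by omega)
      have h2 := norm_localForm_cutoff_right_le m hpq n (j + 1) hx.le le_rfl (i := j) (by omega)
      have h3 := norm_sub_le (localForm m q p (cutoffExt m p q n j) x)
        (localForm m q p (cutoffExt m p q n (j + 1)) x)
      have h4 : localForm m q p (fun z => cutoffExt m p q n j z - cutoffExt m p q n (j + 1) z) x =
          localForm m q p (cutoffExt m p q n j) x - localForm m q p (cutoffExt m p q n (j + 1)) x := by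
        simp only [localForm, sub_mul]
      rw [h4]
      linarith
  choose c hc using hlim
  refine ⟨c, fun ε hε => ?_, hc⟩
  have hr0 : 0 < min ε (1 / 2) := lt_min hε (by norm_num)
  obtain ⟨C, hC0, hC⟩ := carried_bound m hpq hL hr0 (min_le_right ε (1 / 2))
  refine ⟨C * 2, fun n => ?_⟩
  refine le_of_tendsto (hc n).norm (Filter.Eventually.of_forall fun j => ?_)
  have h1 : ‖L (cutoff m hpq n j)‖ ≤ C * (2 * min ε (1 / 2) ^ n) :=
    hC _ (cutoffExt m p q n j)
      (fun z hz => analyticAt_cutoffExt_axisNhd m hpq n j (min_le_right ε (1 / 2)) hz)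
      (analyticAt_cutoffExt_circle m hpq n j) (fun z => rfl) _ (by positivity) fun x hx =>
      ⟨norm_localForm_cutoff_left_le m hpq n j hx.le (min_le_right _ _),
        norm_localForm_cutoff_right_le m hpq n j hx.le (min_le_right _ _) (by omega)⟩
  rw [← mul_assoc] at h1
  refine h1.trans ?_
  gcongr
  exact min_le_left _ _

end LocalBounds

/-! ### Hyperfunctions carried by two points as pairs of sequences -/

section Pairing

lemma exists_bound_of_analyticAt {f : ℂ → ℂ} (hf : AnalyticAt ℂ f 0) :
    ∃ R M : ℝ, 0 < R ∧ (∀ x, ‖x‖ < R → AnalyticAt ℂ f x) ∧ ∀ x, ‖x‖ < R → ‖f x‖ ≤ M := by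
  have h1 : ∀ᶠ x in 𝓝 (0 : ℂ), ‖f x‖ < ‖f 0‖ + 1 :=
    hf.continuousAt.norm.eventually (gt_mem_nhds (by linarith))
  obtain ⟨R, hR, h⟩ := Metric.eventually_nhds_iff_ball.1 (hf.eventually_analyticAt.and h1)
  exact ⟨R, ‖f 0‖ + 1, hR, fun x hx => (h x (mem_ball_zero_iff.2 hx)).1,
    fun x hx => (h x (mem_ball_zero_iff.2 hx)).2.le⟩

/-- A rapidly decreasing sequence pairs with the holomorphic functions on any disc. -/
lemma exists_pairing_bound {c : ℕ → ℂ} (hc : c ∈ rapid) {R : ℝ} (hR : 0 < R) :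
    ∃ C : ℝ, 0 ≤ C ∧ ∀ (f : ℂ → ℂ) (M : ℝ), (∀ x, ‖x‖ < R → AnalyticAt ℂ f x) →
      (∀ x, ‖x‖ < R → ‖f x‖ ≤ M) →
      Summable (fun n => c n * taylorCoeff n f) ∧ ‖∑' n, c n * taylorCoeff n f‖ ≤ C * M := by
  obtain ⟨C, hC⟩ := hc (R / 4) (by positivity)
  have hC0 : 0 ≤ C := (norm_nonneg _).trans ((hC 0).trans_eq (by simp))
  refine ⟨C * 2, by positivity, fun f M hf hM => ?_⟩
  have h : ∀ n, ‖c n * taylorCoeff n f‖ ≤ C * M * (1 / 2) ^ n := by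
    intro n
    rw [norm_mul]
    calc _ ≤ C * (R / 4) ^ n * (M * (2 / R) ^ n) :=
          mul_le_mul (hC n) (norm_taylorCoeff_le hR hf hM n) (norm_nonneg _) (by positivity)
      _ = C * M * ((R / 4) * (2 / R)) ^ n := by rw [mul_pow]; ring
      _ = C * M * (1 / 2) ^ n := by
          congr 2
          field_simp
          norm_num
  have hs : HasSum (fun n : ℕ => C * M * (1 / 2 : ℝ) ^ n) (C * M * 2) :=
    hasSum_geometric_two.mul_left (C * M)
  refine ⟨Summable.of_norm_bounded hs.summable h, ?_⟩
  refine (tsum_of_norm_bounded hs h).trans_eq ?_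
  ring

lemma summable_pairing {c : ℕ → ℂ} (hc : c ∈ rapid) {f : ℂ → ℂ} (hf : AnalyticAt ℂ f 0) :
    Summable (fun n => c n * taylorCoeff n f) := by
  obtain ⟨R, M, hR, h1, h2⟩ := exists_bound_of_analyticAt hf
  obtain ⟨C, -, hC⟩ := exists_pairing_bound hc hR
  exact (hC f M h1 h2).1

variable {p q : Circle}

lemma summable_coeffAt (m : ℕ) (hpq : p ≠ q) {c : ℕ → ℂ} (hc : c ∈ rapid) (φ : Analytic) :
    Summable (fun n => c n * coeffAt m p q n φ) :=
  summable_pairing hc (analyticAt_localForm_zero m hpq (extension_analyticAt φ p))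

/-- The functional `φ ↦ ∑ cₙ aₙ(φ)` on sections of `T ^ m`, where `aₙ(φ)` are the Taylor
coefficients at `p`. -/
def germFunctional (m : ℕ) (hpq : p ≠ q) : rapid →ₗ[ℂ] Module.Dual ℂ Analytic where
  toFun c :=
    { toFun := fun φ => ∑' n, c.1 n * coeffAt m p q n φ
      map_add' := fun φ ψ => by
        rw [← (summable_coeffAt m hpq c.2 φ).tsum_add (summable_coeffAt m hpq c.2 ψ)]
        congr 1
        funext n
        rw [coeffAt_add m hpq, mul_add]
      map_smul' := fun a φ => by
        rw [RingHom.id_apply, smul_eq_mul, ← tsum_mul_left]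
        congr 1
        funext n
        rw [coeffAt_smul m hpq, mul_left_comm] }
  map_add' c d := by
    ext φ
    simp only [LinearMap.coe_mk, AddHom.coe_mk, LinearMap.add_apply]
    rw [← (summable_coeffAt m hpq c.2 φ).tsum_add (summable_coeffAt m hpq d.2 φ)]
    congr 1
    funext n
    exact add_mul _ _ _
  map_smul' a c := by
    ext φ
    simp only [LinearMap.coe_mk, AddHom.coe_mk, LinearMap.smul_apply, RingHom.id_apply, smul_eq_mul]
    rw [← tsum_mul_left]
    congr 1
    funext n
    exact mul_assoc _ _ _

lemma germFunctional_apply (m : ℕ) (hpq : p ≠ q) (c : rapid) (φ : Analytic) :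
    germFunctional m hpq c φ = ∑' n, c.1 n * coeffAt m p q n φ := rfl

lemma germFunctional_eq (m : ℕ) (hpq : p ≠ q) (c : rapid) {φ : Analytic} {F : ℂ → ℂ}
    (hF : AnalyticAt ℂ F p) (hφ : ∀ z : Circle, F z = φ.1 z) :
    germFunctional m hpq c φ = ∑' n, c.1 n * taylorCoeff n (localForm m p q F) := by
  rw [germFunctional_apply]
  congr 1
  funext n
  rw [coeffAt_eq m hpq n hF hφ]

lemma germFunctional_mem_carried (m : ℕ) (hpq : p ≠ q) (c : rapid) {K : Set Circle} (hK : p ∈ K) :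
    germFunctional m hpq c ∈ carried K := by
  intro U hU hKU
  have h1 : ∀ᶠ x in 𝓝 (0 : ℂ), axisParam p q x ∈ U :=
    (analyticAt_axisParam hpq (x := 0) (by simp)).continuousAt.eventually
      (hU.mem_nhds (by rw [axisParam_zero hpq]; exact hKU p hK))
  obtain ⟨R, hR, h⟩ := Metric.eventually_nhds_iff_ball.1 h1
  have hR1 : 0 < min R 1 := lt_min hR one_pos
  obtain ⟨C, hC0, hC⟩ := exists_pairing_bound c.2 hR1
  refine ⟨C * (4 / ‖(p : ℂ) - q‖ ^ 2) ^ m, fun φ F hF hφ M hM hFM => ?_⟩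
  rw [germFunctional_eq m hpq c (hF _ (Or.inr (mem_sphere_zero_iff_norm.2 (Circle.norm_coe p)))) hφ,
    mul_assoc]
  have hxU : ∀ x : ℂ, ‖x‖ < min R 1 → axisParam p q x ∈ U := fun x hx =>
    h x (mem_ball_zero_iff.2 (hx.trans_le (min_le_left _ _)))
  refine (hC _ _ (fun x hx => ?_) (fun x hx => ?_)).2
  · exact analyticAt_localForm m hpq (hx.trans_le (min_le_right _ _)) (hF _ (Or.inl (hxU x hx)))
  · rw [localForm, norm_mul, norm_pow, mul_comm]
    gcongr
    · exact norm_axisJac_le hpq (hx.le.trans (min_le_right _ _))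
    · exact hFM _ (hxU x hx)

lemma tendsto_germFunctional_cutoff_left (m : ℕ) (hpq : p ≠ q) (c : rapid) (n : ℕ) :
    Filter.Tendsto (fun j => germFunctional m hpq c (cutoff m hpq n j)) Filter.atTop
      (𝓝 (c.1 n)) := by
  obtain ⟨C, hC0, hC⟩ := exists_pairing_bound c.2 (R := 1 / 2) (by norm_num)
  rw [tendsto_iff_norm_sub_tendsto_zero]
  have hlim : Filter.Tendsto (fun j : ℕ => C * (2 * (1 / 2 : ℝ) ^ j)) Filter.atTop (𝓝 0) := by
    have := tendsto_pow_atTop_nhds_zero_of_lt_one (r := (1 / 2 : ℝ)) (by norm_num) (by norm_num)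
    simpa using (this.const_mul 2).const_mul C
  refine squeeze_zero (fun j => norm_nonneg _) (fun j => ?_) hlim
  have han : ∀ x : ℂ, ‖x‖ < 1 / 2 → AnalyticAt ℂ (localForm m p q (cutoffExt m p q n j)) x := by
    intro x hx
    exact analyticAt_localForm m hpq (by linarith) (analyticAt_cutoffExt_axisNhd m hpq n j le_rfl
      (axisParam_mem_axisNhd hpq hx (by norm_num)))
  have h0 := han 0 (by simp)
  have hpow : AnalyticAt ℂ (fun x : ℂ => x ^ n) 0 := by fun_prop
  have hsum : HasSum (fun i => c.1 i * taylorCoeff i (fun x : ℂ => x ^ n)) (c.1 n) := by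
    have := hasSum_ite_eq n (c.1 n)
    convert! this using 2 with i
    rw [taylorCoeff_pow]
    split_ifs with h
    · rw [h, mul_one]
    · rw [mul_zero]
  have hb := (hC (fun x => localForm m p q (cutoffExt m p q n j) x - x ^ n) (2 * (1 / 2) ^ j)
    (fun x hx => (han x hx).sub (by fun_prop))
    (fun x hx => norm_localForm_cutoff_left_sub_le m hpq n j hx.le le_rfl)).2
  rw [germFunctional_eq m hpq c (analyticAt_cutoffExt_circle m hpq n j p) (fun z => rfl),
    ← hsum.tsum_eq, ← (summable_pairing c.2 h0).tsum_sub hsum.summable]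
  convert! hb using 4 with i
  rw [taylorCoeff_sub h0 hpow, mul_sub]

lemma tendsto_germFunctional_cutoff_right (m : ℕ) (hpq : p ≠ q) (c : rapid) (n : ℕ) :
    Filter.Tendsto (fun j => germFunctional m hpq c (cutoff m hpq.symm n j)) Filter.atTop
      (𝓝 0) := by
  obtain ⟨C, hC0, hC⟩ := exists_pairing_bound c.2 (R := 1 / 2) (by norm_num)
  rw [tendsto_zero_iff_norm_tendsto_zero]
  have hlim : Filter.Tendsto (fun j : ℕ => C * (2 * (1 / 2 : ℝ) ^ j)) Filter.atTop (𝓝 0) := by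
    have := tendsto_pow_atTop_nhds_zero_of_lt_one (r := (1 / 2 : ℝ)) (by norm_num) (by norm_num)
    simpa using (this.const_mul 2).const_mul C
  refine squeeze_zero (fun j => norm_nonneg _) (fun j => ?_) hlim
  rw [germFunctional_eq m hpq c (analyticAt_cutoffExt_circle m hpq.symm n j p) (fun z => rfl)]
  refine (hC _ _ (fun x hx => ?_) (fun x hx => ?_)).2
  · exact analyticAt_localForm m hpq (by linarith) (analyticAt_cutoffExt_axisNhd m hpq.symm n j
      le_rfl (axisNhd_swap p q _ ▸ axisParam_mem_axisNhd hpq hx (by norm_num)))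
  · exact norm_localForm_cutoff_right_le m hpq.symm n j hx.le le_rfl (by omega)

/-- A functional carried by `{p, q}` vanishes if all its moments at `p` and `q` vanish: the
sections that look like Taylor polynomials near `p` and near `q` are dense. -/
lemma eq_zero_of_moments (m : ℕ) (hpq : p ≠ q) {L : Module.Dual ℂ Analytic}
    (hL : L ∈ carried {p, q})
    (h1 : ∀ n, Filter.Tendsto (fun j => L (cutoff m hpq n j)) Filter.atTop (𝓝 0))
    (h2 : ∀ n, Filter.Tendsto (fun j => L (cutoff m hpq.symm n j)) Filter.atTop (𝓝 0)) :
    L = 0 := by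
  ext φ
  rw [LinearMap.zero_apply]
  set F := extension φ
  obtain ⟨R₁, M₁, hR₁, ha₁, hb₁⟩ := exists_bound_of_analyticAt
    (analyticAt_localForm_zero m hpq (extension_analyticAt φ p))
  obtain ⟨R₂, M₂, hR₂, ha₂, hb₂⟩ := exists_bound_of_analyticAt
    (analyticAt_localForm_zero m hpq.symm (extension_analyticAt φ q))
  have hFp : ∀ᶠ x in 𝓝 (0 : ℂ), AnalyticAt ℂ F (axisParam p q x) :=
    (analyticAt_axisParam hpq (x := 0) (by simp)).continuousAt.eventually
      (by rw [axisParam_zero hpq]; exact (extension_analyticAt φ p).eventually_analyticAt)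
  have hFq : ∀ᶠ x in 𝓝 (0 : ℂ), AnalyticAt ℂ F (axisParam q p x) :=
    (analyticAt_axisParam hpq.symm (x := 0) (by simp)).continuousAt.eventually
      (by rw [axisParam_zero hpq.symm]; exact (extension_analyticAt φ q).eventually_analyticAt)
  obtain ⟨R₃, hR₃, hF⟩ := Metric.eventually_nhds_iff_ball.1 (hFp.and hFq)
  obtain ⟨r, hr0, hr₁, hr₂, hr₃, hr⟩ : ∃ r : ℝ, 0 < r ∧ r ≤ R₁ / 4 ∧ r ≤ R₂ / 4 ∧ r ≤ R₃ ∧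
      r ≤ 1 / 2 := by
    refine ⟨min (min (R₁ / 4) (R₂ / 4)) (min R₃ (1 / 2)), by positivity, ?_, ?_, ?_, ?_⟩
    · exact (min_le_left _ _).trans (min_le_left _ _)
    · exact (min_le_left _ _).trans (min_le_right _ _)
    · exact (min_le_right _ _).trans (min_le_left _ _)
    · exact (min_le_right _ _).trans (min_le_right _ _)
  obtain ⟨C, hC0, hC⟩ := carried_bound m hpq hL hr0 hr
  set a : ℕ → ℂ := fun n => taylorCoeff n (localForm m p q F)
  set b : ℕ → ℂ := fun n => taylorCoeff n (localForm m q p F)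
  set M := max M₁ M₂
  have hM0 : 0 ≤ M := (norm_nonneg _).trans ((hb₁ 0 (by simpa using hR₁)).trans (le_max_left _ _))
  have hrp : Filter.Tendsto (fun j : ℕ => r ^ j) Filter.atTop (𝓝 0) :=
    tendsto_pow_atTop_nhds_zero_of_lt_one hr0.le (by linarith)
  -- The contribution of the Taylor polynomials of degree less than `N` at both points.
  have key : ∀ N : ℕ, ‖L φ‖ ≤ C * (2 * M * (1 / 2) ^ N) := by
    intro N
    let D : ℝ := ∑ n ∈ Finset.range N, (‖a n‖ + ‖b n‖) * 2
    let ψ : ℕ → Analytic := fun j => ∑ n ∈ Finset.range N,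
      (a n • cutoff m hpq n j + b n • cutoff m hpq.symm n j)
    have hψ : Filter.Tendsto (fun j => L (ψ j)) Filter.atTop (𝓝 0) := by
      have : Filter.Tendsto (fun j => ∑ n ∈ Finset.range N,
          (a n * L (cutoff m hpq n j) + b n * L (cutoff m hpq.symm n j))) Filter.atTop
          (𝓝 (∑ n ∈ Finset.range N, (a n * 0 + b n * 0))) :=
        tendsto_finsetSum _ fun n _ => ((h1 n).const_mul _).add ((h2 n).const_mul _)
      simpa [ψ] using this
    have hbound : ∀ j, ‖L φ - L (ψ j)‖ ≤ C * (2 * M * (1 / 2) ^ N + D * r ^ j) := by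
      intro j
      rw [← map_sub]
      have hD : 0 ≤ D := Finset.sum_nonneg fun n _ => by positivity
      refine hC _ (fun z => F z - ∑ n ∈ Finset.range N,
        (a n * cutoffExt m p q n j z + b n * cutoffExt m q p n j z)) ?_ ?_ ?_ _
        (by positivity) ?_
      · intro z hz
        refine AnalyticAt.sub ?_ (Finset.analyticAt_fun_sum _ fun n _ => ?_)
        · rcases hz with hz | hz
          · obtain ⟨x, hx, rfl⟩ := exists_axisParam_eq hpq hz
            exact (hF x (mem_ball_zero_iff.2 (hx.trans_le hr₃))).1
          · obtain ⟨x, hx, rfl⟩ := exists_axisParam_eq hpq.symm hz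
            exact (hF x (mem_ball_zero_iff.2 (hx.trans_le hr₃))).2
        · exact (analyticAt_const.mul (analyticAt_cutoffExt_axisNhd m hpq n j hr hz)).add
            (analyticAt_const.mul (analyticAt_cutoffExt_axisNhd m hpq.symm n j hr
              (axisNhd_swap p q r ▸ hz)))
      · intro z
        refine (extension_analyticAt φ z).sub (Finset.analyticAt_fun_sum _ fun n _ => ?_)
        exact (analyticAt_const.mul (analyticAt_cutoffExt_circle m hpq n j z)).add
            (analyticAt_const.mul (analyticAt_cutoffExt_circle m hpq.symm n j z))
      · intro z
        have : ∀ s : Finset ℕ, (∑ n ∈ s,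
            (a n • cutoff m hpq n j + b n • cutoff m hpq.symm n j)).1 z =
            ∑ n ∈ s, (a n * cutoffExt m p q n j z + b n * cutoffExt m q p n j z) := by
          intro s
          rw [AddSubmonoidClass.coe_finsetSum, Finset.sum_apply]
          rfl
        change F z - _ = φ.1 z - (ψ j).1 z
        rw [this, show F z = φ.1 z from extension_apply φ z]
      · -- Near each point the polynomial of that point approximates, and the other is small.
        have hloc : ∀ (P Q : Circle) (x : ℂ), localForm m P Q (fun z => F z - ∑ n ∈ Finset.range N,
            (a n * cutoffExt m p q n j z + b n * cutoffExt m q p n j z)) x =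
            localForm m P Q F x - ∑ n ∈ Finset.range N,
            (a n * localForm m P Q (cutoffExt m p q n j) x +
              b n * localForm m P Q (cutoffExt m q p n j) x) := by
          intro P Q x
          simp only [localForm, sub_mul, Finset.sum_mul, add_mul, mul_assoc]
        intro x hx
        have hrj : 0 ≤ r ^ j := by positivity
        constructor
        · have e1 := norm_sub_taylor_le hR₁ ha₁
            (fun x hx => (hb₁ x hx).trans (le_max_left M₁ M₂)) N (hx.le.trans hr₁)
          have e2 : ‖∑ n ∈ Finset.range N, (a n * (localForm m p q (cutoffExt m p q n j) x - x ^ n) +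
              b n * localForm m p q (cutoffExt m q p n j) x)‖ ≤ D * r ^ j := by
            rw [Finset.sum_mul]
            refine norm_sum_le_of_le _ fun n _ => (norm_add_le _ _).trans ?_
            rw [norm_mul, norm_mul]
            have i1 := norm_localForm_cutoff_left_sub_le m hpq n j hx.le hr
            have i2 := norm_localForm_cutoff_right_le m hpq.symm n j hx.le hr (i := j) (by omega)
            nlinarith [mul_le_mul_of_nonneg_left i1 (norm_nonneg (a n)),
              mul_le_mul_of_nonneg_left i2 (norm_nonneg (b n))]
          rw [hloc]
          have e3 : localForm m p q F x - ∑ n ∈ Finset.range N,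
            (a n * localForm m p q (cutoffExt m p q n j) x +
              b n * localForm m p q (cutoffExt m q p n j) x) =
            (localForm m p q F x - ∑ n ∈ Finset.range N, a n * x ^ n) -
            ∑ n ∈ Finset.range N, (a n * (localForm m p q (cutoffExt m p q n j) x - x ^ n) +
              b n * localForm m p q (cutoffExt m q p n j) x) := by
            rw [sub_sub, ← Finset.sum_add_distrib]
            congr 1
            refine Finset.sum_congr rfl fun n _ => ?_
            ring
          rw [e3]
          exact (norm_sub_le _ _).trans (add_le_add e1 e2)
        · have e1 := norm_sub_taylor_le hR₂ ha₂
            (fun x hx => (hb₂ x hx).trans (le_max_right M₁ M₂)) N (hx.le.trans hr₂)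
          have e2 : ‖∑ n ∈ Finset.range N, (a n * localForm m q p (cutoffExt m p q n j) x +
              b n * (localForm m q p (cutoffExt m q p n j) x - x ^ n))‖ ≤ D * r ^ j := by
            rw [Finset.sum_mul]
            refine norm_sum_le_of_le _ fun n _ => (norm_add_le _ _).trans ?_
            rw [norm_mul, norm_mul]
            have i1 := norm_localForm_cutoff_left_sub_le m hpq.symm n j hx.le hr
            have i2 := norm_localForm_cutoff_right_le m hpq n j hx.le hr (i := j) (by omega)
            nlinarith [mul_le_mul_of_nonneg_left i1 (norm_nonneg (b n)),
              mul_le_mul_of_nonneg_left i2 (norm_nonneg (a n))]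
          rw [hloc]
          have e3 : localForm m q p F x - ∑ n ∈ Finset.range N,
            (a n * localForm m q p (cutoffExt m p q n j) x +
              b n * localForm m q p (cutoffExt m q p n j) x) =
            (localForm m q p F x - ∑ n ∈ Finset.range N, b n * x ^ n) -
            ∑ n ∈ Finset.range N, (a n * localForm m q p (cutoffExt m p q n j) x +
              b n * (localForm m q p (cutoffExt m q p n j) x - x ^ n)) := by
            rw [sub_sub, ← Finset.sum_add_distrib]
            congr 1
            refine Finset.sum_congr rfl fun n _ => ?_
            ring
          rw [e3]
          exact (norm_sub_le _ _).trans (add_le_add e1 e2)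
    have hl : Filter.Tendsto (fun j => ‖L φ - L (ψ j)‖) Filter.atTop (𝓝 ‖L φ - 0‖) :=
      (tendsto_const_nhds.sub hψ).norm
    have hrhs : Filter.Tendsto (fun j => C * (2 * M * (1 / 2) ^ N + D * r ^ j)) Filter.atTop
        (𝓝 (C * (2 * M * (1 / 2) ^ N + D * 0))) :=
      ((hrp.const_mul D).const_add _).const_mul C
    have := le_of_tendsto_of_tendsto' hl hrhs hbound
    simpa using this
  have hlim : Filter.Tendsto (fun N : ℕ => C * (2 * M * (1 / 2 : ℝ) ^ N)) Filter.atTop (𝓝 0) := by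
    have := tendsto_pow_atTop_nhds_zero_of_lt_one (r := (1 / 2 : ℝ)) (by norm_num) (by norm_num)
    simpa using (this.const_mul (2 * M)).const_mul C
  exact norm_le_zero_iff.1 (ge_of_tendsto' hlim key)

/-- The functional `φ ↦ ∑ cₙ aₙ(φ) + ∑ dₙ bₙ(φ)`, where `aₙ(φ)` and `bₙ(φ)` are the Taylor
coefficients at `p` and at `q`. -/
def pairFunctional (m : ℕ) (hpq : p ≠ q) : rapid × rapid →ₗ[ℂ] Module.Dual ℂ Analytic :=
  (germFunctional m hpq).coprod (germFunctional m hpq.symm)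

lemma pairFunctional_apply (m : ℕ) (hpq : p ≠ q) (c d : rapid) :
    pairFunctional m hpq (c, d) = germFunctional m hpq c + germFunctional m hpq.symm d := rfl

lemma tendsto_pairFunctional_left (m : ℕ) (hpq : p ≠ q) (c d : rapid) (n : ℕ) :
    Filter.Tendsto (fun j => pairFunctional m hpq (c, d) (cutoff m hpq n j)) Filter.atTop
      (𝓝 (c.1 n)) := by
  have := (tendsto_germFunctional_cutoff_left m hpq c n).add
    (tendsto_germFunctional_cutoff_right m hpq.symm d n)
  rwa [add_zero] at this

lemma tendsto_pairFunctional_right (m : ℕ) (hpq : p ≠ q) (c d : rapid) (n : ℕ) :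
    Filter.Tendsto (fun j => pairFunctional m hpq (c, d) (cutoff m hpq.symm n j)) Filter.atTop
      (𝓝 (d.1 n)) := by
  have := (tendsto_germFunctional_cutoff_right m hpq c n).add
    (tendsto_germFunctional_cutoff_left m hpq.symm d n)
  rwa [zero_add] at this

lemma pairFunctional_injective (m : ℕ) (hpq : p ≠ q) :
    Function.Injective (pairFunctional m hpq) := by
  rw [← LinearMap.ker_eq_bot, LinearMap.ker_eq_bot']
  rintro ⟨c, d⟩ h
  have h1 := tendsto_pairFunctional_left m hpq c d
  have h2 := tendsto_pairFunctional_right m hpq c d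
  rw [h] at h1 h2
  refine Prod.ext (Subtype.ext (funext fun n => ?_)) (Subtype.ext (funext fun n => ?_))
  · exact tendsto_nhds_unique (h1 n) tendsto_const_nhds
  · exact tendsto_nhds_unique (h2 n) tendsto_const_nhds

/-- The hyperfunctions with support in `{p, q}` are the pairs of rapidly decreasing sequences. -/
lemma range_pairFunctional (m : ℕ) (hpq : p ≠ q) :
    LinearMap.range (pairFunctional m hpq) = carried {p, q} := by
  have hmem : ∀ c d : rapid, pairFunctional m hpq (c, d) ∈ carried {p, q} := fun c d =>
    add_mem (germFunctional_mem_carried m hpq c (by simp))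
      (germFunctional_mem_carried m hpq.symm d (by simp))
  apply le_antisymm
  · rintro _ ⟨⟨c, d⟩, rfl⟩
    exact hmem c d
  · intro L hL
    obtain ⟨c, hc, hc'⟩ := exists_moments m hpq hL
    obtain ⟨d, hd, hd'⟩ := exists_moments m hpq.symm (L := L) (by rwa [Set.pair_comm])
    refine ⟨(⟨c, hc⟩, ⟨d, hd⟩), ?_⟩
    rw [eq_comm, ← sub_eq_zero]
    refine eq_zero_of_moments m hpq (sub_mem hL (hmem _ _)) (fun n => ?_) (fun n => ?_)
    · have := (hc' n).sub (tendsto_pairFunctional_left m hpq ⟨c, hc⟩ ⟨d, hd⟩ n)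
      rwa [sub_self] at this
    · have := (hd' n).sub (tendsto_pairFunctional_right m hpq ⟨c, hc⟩ ⟨d, hd⟩ n)
      rwa [sub_self] at this

end Pairing

/-! ### Diagonal operators on rapidly decreasing sequences -/

section DiagonalAction

lemma mul_mem_rapid {a c : ℕ → ℂ} {A B : ℝ} (hB : 0 < B) (ha : ∀ n, ‖a n‖ ≤ A * B ^ n)
    (hc : c ∈ rapid) : (fun n => a n * c n) ∈ rapid := by
  intro ε hε
  obtain ⟨C, hC⟩ := hc (ε / B) (by positivity)
  refine ⟨A * C, fun n => ?_⟩
  rw [norm_mul]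
  calc ‖a n‖ * ‖c n‖ ≤ (A * B ^ n) * (C * (ε / B) ^ n) :=
        mul_le_mul (ha n) (hC n) (norm_nonneg _) ((norm_nonneg _).trans (ha n))
    _ = A * C * (B * (ε / B)) ^ n := by rw [mul_pow]; ring
    _ = A * C * ε ^ n := by rw [mul_div_cancel₀ _ hB.ne']

/-- Multiplication of the `n`-th term by `κ ^ (n - m)`. -/
def scale (m : ℕ) (κ : ℂ) : rapid →ₗ[ℂ] rapid where
  toFun c := ⟨fun n => κ ^ n / κ ^ m * c.1 n,
    mul_mem_rapid (A := ‖(κ ^ m)⁻¹‖) (B := ‖κ‖ + 1) (by positivity) (fun n => by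
      rw [div_eq_inv_mul, norm_mul, norm_pow]
      gcongr
      linarith) c.2⟩
  map_add' c d := Subtype.ext (funext fun n => mul_add _ _ _)
  map_smul' a c := Subtype.ext (funext fun n => mul_left_comm _ _ _)

lemma scale_apply (m : ℕ) (κ : ℂ) (c : rapid) (n : ℕ) :
    (scale m κ c).1 n = κ ^ n / κ ^ m * c.1 n := rfl

/-- The `n`-th unit sequence. -/
def unitSeq (n : ℕ) : rapid :=
  ⟨Pi.single n 1, fun ε hε => ⟨(ε ^ n)⁻¹, fun i => by
    by_cases h : i = n
    · subst h
      rw [Pi.single_eq_same, norm_one, inv_mul_cancel₀ (by positivity)]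
    · rw [Pi.single_eq_of_ne h, norm_zero]
      positivity⟩⟩

lemma unitSeq_same (n : ℕ) : (unitSeq n).1 n = 1 := Pi.single_eq_same n 1

lemma unitSeq_ne {n i : ℕ} (h : i ≠ n) : (unitSeq n).1 i = 0 := Pi.single_eq_of_ne h 1

variable {m : ℕ} {κ : ℂ}

lemma scale_unitSeq (h0 : κ ≠ 0) : scale m κ (unitSeq m) = unitSeq m := by
  ext n
  rw [scale_apply]
  by_cases h : n = m
  · rw [h, div_self (pow_ne_zero m h0), one_mul]
  · rw [unitSeq_ne h, mul_zero]

lemma scale_sub_apply_same (h0 : κ ≠ 0) (c : rapid) : (scale m κ c - c).1 m = 0 := by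
  change (scale m κ c).1 m - c.1 m = 0
  rw [scale_apply, div_self (pow_ne_zero m h0), one_mul, sub_self]

/-- The eigenvalues of `scale` other than that at `m` stay away from `1`. -/
lemma exists_gap (h0 : κ ≠ 0) (h1 : ‖κ‖ ≠ 1) :
    ∃ δ : ℝ, 0 < δ ∧ ∀ n, n ≠ m → δ ≤ ‖κ ^ n / κ ^ m - 1‖ := by
  have hκ : 0 < ‖κ‖ := norm_pos_iff.2 h0
  have hgap : ∀ t : ℝ, 1 < t → ∀ j : ℕ, 1 ≤ j → 1 - t⁻¹ ≤ t ^ j - 1 ∧ 1 - t⁻¹ ≤ 1 - (t ^ j)⁻¹ := by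
    intro t ht j hj
    have h2 : t ≤ t ^ j := le_self_pow₀ ht.le (by omega)
    have h3 : (t ^ j)⁻¹ ≤ t⁻¹ := inv_anti₀ (by linarith) h2
    have h4 : t⁻¹ * t = 1 := inv_mul_cancel₀ (by linarith)
    exact ⟨by nlinarith, by linarith⟩
  -- The estimate for a real number `t`, in terms of the larger one of `t` and `t⁻¹`.
  have hnorm : ∀ n, |‖κ‖ ^ n / ‖κ‖ ^ m - 1| ≤ ‖κ ^ n / κ ^ m - 1‖ := by
    intro n
    have := abs_norm_sub_norm_le (κ ^ n / κ ^ m) 1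
    rwa [norm_div, norm_pow, norm_pow, norm_one] at this
  rcases lt_or_gt_of_ne h1 with h | h
  · have ht : 1 < ‖κ‖⁻¹ := (one_lt_inv₀ hκ).2 h
    refine ⟨1 - ‖κ‖⁻¹⁻¹, sub_pos.2 (inv_lt_one_of_one_lt₀ ht), fun n hn => ?_⟩
    refine le_trans ?_ (hnorm n)
    rcases lt_or_gt_of_ne hn with hlt | hlt
    · obtain ⟨j, rfl⟩ := Nat.exists_eq_add_of_lt hlt
      have := (hgap _ ht (j + 1) (by omega)).1
      refine this.trans (le_trans (le_of_eq ?_) (le_abs_self _))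
      rw [inv_pow, add_assoc, pow_add]
      field_simp
      ring
    · obtain ⟨j, rfl⟩ := Nat.exists_eq_add_of_lt hlt
      have := (hgap _ ht (j + 1) (by omega)).2
      refine this.trans (le_trans (le_of_eq ?_) (neg_le_abs _))
      rw [inv_pow, add_assoc, pow_add]
      field_simp
      ring
  · refine ⟨1 - ‖κ‖⁻¹, sub_pos.2 (inv_lt_one_of_one_lt₀ h), fun n hn => ?_⟩
    refine le_trans ?_ (hnorm n)
    rcases lt_or_gt_of_ne hn with hlt | hlt
    · obtain ⟨j, rfl⟩ := Nat.exists_eq_add_of_lt hlt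
      have := (hgap _ h (j + 1) (by omega)).2
      refine this.trans (le_trans (le_of_eq ?_) (neg_le_abs _))
      rw [add_assoc, pow_add]
      field_simp
      ring
    · obtain ⟨j, rfl⟩ := Nat.exists_eq_add_of_lt hlt
      have := (hgap _ h (j + 1) (by omega)).1
      refine this.trans (le_trans (le_of_eq ?_) (le_abs_self _))
      rw [add_assoc, pow_add]
      field_simp
      ring

lemma eq_smul_unitSeq_of_scale_eq (h0 : κ ≠ 0) (h1 : ‖κ‖ ≠ 1) {c : rapid} (h : scale m κ c = c) :
    c = c.1 m • unitSeq m := by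
  obtain ⟨δ, hδ, hgap⟩ := exists_gap (m := m) h0 h1
  ext n
  change c.1 n = c.1 m * (unitSeq m).1 n
  by_cases hn : n = m
  · rw [hn, unitSeq_same, mul_one]
  · have h2 := congrArg (fun c : rapid => c.1 n) h
    simp only [scale_apply] at h2
    have h3 : (κ ^ n / κ ^ m - 1) * c.1 n = 0 := by rw [sub_mul, h2, one_mul, sub_self]
    rw [unitSeq_ne hn, mul_zero]
    exact (mul_eq_zero.1 h3).resolve_left (norm_pos_iff.1 (hδ.trans_le (hgap n hn)))

lemma exists_eq_smul_add_scale_sub (h0 : κ ≠ 0) (h1 : ‖κ‖ ≠ 1) (c : rapid) :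
    ∃ b : rapid, c = c.1 m • unitSeq m + (scale m κ b - b) := by
  obtain ⟨δ, hδ, hgap⟩ := exists_gap (m := m) h0 h1
  let a : ℕ → ℂ := fun n => if n = m then 0 else (κ ^ n / κ ^ m - 1)⁻¹
  refine ⟨⟨fun n => a n * c.1 n, mul_mem_rapid (A := δ⁻¹) (B := 1) one_pos (fun n => ?_) c.2⟩, ?_⟩
  · rw [one_pow, mul_one]
    by_cases hn : n = m
    · simp only [a, if_pos hn, norm_zero]
      positivity
    · simp only [a, if_neg hn, norm_inv]
      exact inv_anti₀ hδ (hgap n hn)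
  · ext n
    change c.1 n = c.1 m * (unitSeq m).1 n + (κ ^ n / κ ^ m * (a n * c.1 n) - a n * c.1 n)
    by_cases hn : n = m
    · simp [a, hn, unitSeq_same]
    · have h2 : κ ^ n / κ ^ m - 1 ≠ 0 := norm_pos_iff.1 (hδ.trans_le (hgap n hn))
      simp only [a, if_neg hn, unitSeq_ne hn, mul_zero, zero_add]
      rw [← sub_one_mul, mul_inv_cancel_left₀ h2]

end DiagonalAction

/-! ### Cohomology with diagonal coefficients -/

section DiagonalModule

open groupCohomology

variable {Γ : Type} [Group Γ] (A : Rep.{0} ℂ Γ)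

/-- Cohomology of an infinite cyclic group that acts diagonally on pairs of rapidly decreasing
sequences: the resonant terms, those of index `m`, give everything. -/
theorem cohomology_of_diagonal (m : ℕ) (T : (rapid × rapid) ≃ₗ[ℂ] A) (κ κ' : Γ → ℂ)
    (hκ : ∀ γ, κ γ ≠ 0) (hκ' : ∀ γ, κ' γ ≠ 0)
    (hT : ∀ γ c d, A.ρ γ (T (c, d)) = T (scale m (κ γ) c, scale m (κ' γ) d))
    {γ₀ : Γ} (hgen : ∀ γ : Γ, ∃ n : ℤ, γ₀ ^ n = γ) (h1 : ‖κ γ₀‖ ≠ 1) (h1' : ‖κ' γ₀‖ ≠ 1)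
    (ℓ : Γ → ℂ) (hℓ : ∀ g h, ℓ (g * h) = ℓ g + ℓ h) (hℓ₀ : ℓ γ₀ ≠ 0) :
    Module.finrank ℂ (groupCohomology A 0) = 2 ∧
    Module.finrank ℂ (groupCohomology A 1) = 2 ∧
    (∀ c : groupCohomology A 0, ∃ α β : ℂ,
      ((H0Iso A).hom c).1 = T (α • unitSeq m, β • unitSeq m)) ∧
    (∀ c : groupCohomology A 1, ∃ z : cocycles₁ A, H1π A z = c ∧
      ∀ γ : Γ, ∃ α β : ℂ, z γ = T (α • unitSeq m, β • unitSeq m)) := by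
  let u : ℂ →ₗ[ℂ] rapid := LinearMap.toSpanSingleton ℂ rapid (unitSeq m)
  have hu : Function.Injective u := by
    rw [← LinearMap.ker_eq_bot, LinearMap.ker_eq_bot']
    intro a ha
    have h : a * (unitSeq m).1 m = 0 := congrArg (fun c : rapid => c.1 m) ha
    rwa [unitSeq_same, mul_one] at h
  let J : ℂ × ℂ →ₗ[ℂ] A := T.toLinearMap ∘ₗ u.prodMap u
  have hJapply : ∀ α β : ℂ, J (α, β) = T (α • unitSeq m, β • unitSeq m) := fun _ _ => rfl
  have hJ : Function.Injective J := T.injective.comp (hu.prodMap hu)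
  have hdim : Module.finrank ℂ (LinearMap.range J) = 2 := by
    rw [LinearMap.finrank_range_of_inj hJ]
    simp
  obtain ⟨e0, e1, r0, r1⟩ := cohomology_of_generator A hgen ℓ hℓ hℓ₀ (LinearMap.range J) (by
      rintro γ _ ⟨⟨α, β⟩, rfl⟩
      rw [hJapply, hT, map_smul, map_smul, scale_unitSeq (hκ γ), scale_unitSeq (hκ' γ)]) (by
      intro a ha
      obtain ⟨⟨c, d⟩, rfl⟩ := T.surjective a
      rw [hT] at ha
      have h := Prod.ext_iff.1 (T.injective ha)
      refine ⟨(c.1 m, d.1 m), ?_⟩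
      rw [hJapply, ← eq_smul_unitSeq_of_scale_eq (hκ γ₀) h1 h.1,
        ← eq_smul_unitSeq_of_scale_eq (hκ' γ₀) h1' h.2]) (by
      rintro _ ⟨⟨α, β⟩, rfl⟩ a ha
      obtain ⟨⟨c, d⟩, rfl⟩ := T.surjective a
      rw [hT, ← map_sub, hJapply] at ha
      have h := Prod.ext_iff.1 (T.injective ha)
      have hα : (scale m (κ γ₀) c - c).1 m = α * (unitSeq m).1 m :=
        congrArg (fun c : rapid => c.1 m) h.1
      have hβ : (scale m (κ' γ₀) d - d).1 m = β * (unitSeq m).1 m :=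
        congrArg (fun c : rapid => c.1 m) h.2
      rw [scale_sub_apply_same (hκ γ₀), unitSeq_same, mul_one] at hα
      rw [scale_sub_apply_same (hκ' γ₀), unitSeq_same, mul_one] at hβ
      rw [← hα, ← hβ]
      exact map_zero J) (by
      intro a
      obtain ⟨⟨c, d⟩, rfl⟩ := T.surjective a
      obtain ⟨b, hb⟩ := exists_eq_smul_add_scale_sub (m := m) (hκ γ₀) h1 c
      obtain ⟨b', hb'⟩ := exists_eq_smul_add_scale_sub (m := m) (hκ' γ₀) h1' d
      refine ⟨_, ⟨(c.1 m, d.1 m), rfl⟩, T (b, b'), ?_⟩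
      rw [hT, ← map_sub, hJapply, ← map_add]
      congr 1
      exact Prod.ext hb hb')
  refine ⟨e0.trans hdim, e1.trans hdim, fun c => ?_, fun c => ?_⟩
  · obtain ⟨⟨α, β⟩, h⟩ := r0 c
    exact ⟨α, β, h.symm⟩
  · obtain ⟨z, hz, h⟩ := r1 c
    refine ⟨z, hz, fun γ => ?_⟩
    obtain ⟨⟨α, β⟩, h⟩ := h γ
    exact ⟨α, β, h.symm⟩

end DiagonalModule

/-! ### Derivatives of delta distributions -/

section Delta

variable {p q : Circle}

/-- On the real line, the real and the complex derivatives of a holomorphic function agree. -/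
lemma iteratedDeriv_ofReal {G : ℂ → ℂ} (hG : AnalyticAt ℂ G 0) (n : ℕ) :
    iteratedDeriv n (fun t : ℝ => G t) =ᶠ[𝓝 0] fun t : ℝ => iteratedDeriv n G t := by
  induction n with
  | zero => simp
  | succ n ih =>
    have h1 : ∀ᶠ t : ℝ in 𝓝 0, AnalyticAt ℂ G t := by
      have h2 : Filter.Tendsto (fun t : ℝ => (t : ℂ)) (𝓝 0) (𝓝 0) := by
        have := Complex.continuous_ofReal.tendsto 0
        rwa [Complex.ofReal_zero] at this
      exact h2.eventually hG.eventually_analyticAt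
    filter_upwards [ih.deriv, h1] with t ht hGt
    rw [iteratedDeriv_succ, ht, iteratedDeriv_succ]
    have h3 : AnalyticAt ℂ (iteratedDeriv n G) t := by
      rw [iteratedDeriv_eq_iterate]
      exact hGt.iterated_deriv n
    exact h3.differentiableAt.hasDerivAt.comp_ofReal.deriv

/-- The Taylor coefficients at `p` are combinations of derivatives of the delta distribution at `p`:
they vanish on the sections that vanish to the corresponding order at `p`. -/
lemma germFunctional_unitSeq_mem_deltaSpan (m : ℕ) (hpq : p ≠ q) (n : ℕ) {K : Set Circle}
    (hK : p ∈ K) : germFunctional m hpq (unitSeq n) ∈ deltaSpan K := by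
  have hmem : germFunctional m hpq (unitSeq n) ∈
      Submodule.span ℂ (Set.range fun i : Fin (n + 1) => deltaDeriv p i) := by
    apply mem_span_of_iInf_ker_le_ker
    intro φ hφ
    rw [Submodule.mem_iInf] at hφ
    set F := extension φ
    have hF : AnalyticAt ℂ F p := extension_analyticAt φ p
    set e : ℂ → ℂ := fun t => (p : ℂ) * Complex.exp (t * Complex.I)
    have he : AnalyticAt ℂ e 0 := by
      simp only [e]
      fun_prop
    have he0 : e 0 = p := by simp [e]
    have hed : deriv e 0 ≠ 0 := by
      have h1 : HasDerivAt (fun t : ℂ => t * Complex.I) Complex.I 0 := by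
        simpa using (hasDerivAt_id (0 : ℂ)).mul_const Complex.I
      have h2 : HasDerivAt e (p * (Complex.exp (0 * Complex.I) * Complex.I)) 0 :=
        h1.cexp.const_mul (p : ℂ)
      rw [h2.deriv]
      simp [Circle.coe_ne_zero p]
    have hG : AnalyticAt ℂ (F ∘ e) 0 := AnalyticAt.comp (by rwa [he0]) he
    have horder : ((n + 1 : ℕ) : ℕ∞) ≤ analyticOrderAt F p := by
      rw [← he0, ← analyticOrderAt_comp_of_deriv_ne_zero he hed,
        natCast_le_analyticOrderAt_iff_iteratedDeriv_eq_zero hG]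
      intro i hi
      have h1 : (-1) ^ i * iteratedDeriv i (fun t : ℝ => φ.1 (p * Circle.exp t)) 0 = 0 :=
        LinearMap.mem_ker.1 (hφ ⟨i, hi⟩)
      have h2 : (fun t : ℝ => φ.1 (p * Circle.exp t)) = fun t : ℝ => (F ∘ e) t := by
        funext t
        rw [← extension_apply]
        simp [F, e]
      have h3 := (mul_eq_zero.1 h1).resolve_left (pow_ne_zero i (by norm_num))
      rw [h2, (iteratedDeriv_ofReal hG i).eq_of_nhds, Complex.ofReal_zero] at h3
      exact h3
    have hpar := analyticAt_axisParam hpq (x := 0) (by simp)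
    have hpard : deriv (axisParam p q) 0 ≠ 0 := by
      have hc := axisConst_ne_zero hpq
      have h1 : HasDerivAt (fun x : ℂ => axisConst p q * p - q * x) (-q) 0 := by
        simpa using ((hasDerivAt_id (0 : ℂ)).const_mul (q : ℂ)).const_sub (axisConst p q * p)
      have h2 : HasDerivAt (fun x : ℂ => axisConst p q - x) (-1) 0 :=
        (hasDerivAt_id (0 : ℂ)).const_sub (axisConst p q)
      have h3 := h1.div h2 (by simpa using hc)
      have h4 : deriv (axisParam p q) 0 = _ := h3.deriv
      rw [h4]
      simp only [mul_zero, sub_zero]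
      refine div_ne_zero ?_ (pow_ne_zero 2 hc)
      have h5 : -(q : ℂ) * axisConst p q - axisConst p q * p * -1 = axisConst p q * (p - q) := by
        ring
      rw [h5]
      exact mul_ne_zero hc (sub_ne_zero_of_circle_ne hpq)
    have horder' : ((n + 1 : ℕ) : ℕ∞) ≤ analyticOrderAt (localForm m p q F) 0 := by
      have h1 : analyticOrderAt (localForm m p q F) 0 =
          analyticOrderAt (F ∘ axisParam p q) 0 +
            analyticOrderAt (fun x => axisJac p q x ^ m) 0 :=
        analyticOrderAt_mul (AnalyticAt.comp (by rwa [axisParam_zero hpq]) hpar)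
          ((analyticAt_axisJac 0).pow m)
      rw [h1, analyticOrderAt_comp_of_deriv_ne_zero hpar hpard, axisParam_zero hpq]
      exact horder.trans le_self_add
    rw [natCast_le_analyticOrderAt_iff_iteratedDeriv_eq_zero
      (analyticAt_localForm_zero m hpq hF)] at horder'
    rw [LinearMap.mem_ker, germFunctional_apply, tsum_eq_single n (fun i hi => by
      rw [unitSeq_ne hi, zero_mul]), unitSeq_same, one_mul, coeffAt, taylorCoeff,
      horder' n (by omega), zero_div]
  refine Submodule.span_mono ?_ hmem
  rintro _ ⟨i, rfl⟩
  exact ⟨p, hK, i, rfl⟩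

end Delta

/-! ### The module of hyperfunctions with support in the limit set -/

section HyperfunctionModule

variable {p q : Circle}

lemma dual_germFunctional (m : ℕ) (hpq : p ≠ q) {g : SL(2, ℝ)} (hp : mob g p = p)
    (hq : mob g q = q) (c : rapid) :
    (sectionRep m).dual g (germFunctional m hpq c) =
      germFunctional m hpq (scale m (den g q ^ 2) c) := by
  ext φ
  rw [Representation.dual_apply]
  change germFunctional m hpq c (sectionRep m g⁻¹ φ) = _
  rw [germFunctional_apply, germFunctional_apply]
  congr 1
  funext n
  rw [coeffAt_sectionRep m hpq hp hq, scale_apply]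
  ring

lemma toFunctional_ρ (Γ : Subgroup SL(2, ℝ)) (l : ℂ) (γ : Γ) (f : hyperfunctionModule Γ l) :
    toFunctional Γ l ((hyperfunctionModule Γ l).ρ γ f) =
      (sectionRep (-l - 1 / 2)).dual γ.1 (toFunctional Γ l f) := rfl

/-- The hyperfunctions with support in the limit set `{p, q}`, as pairs of sequences. -/
def moduleEquiv (Γ : Subgroup SL(2, ℝ)) (l : ℂ) (m : ℕ) (hpq : p ≠ q)
    (hΛ : limitSet Γ = {p, q}) : (rapid × rapid) ≃ₗ[ℂ] hyperfunctionModule Γ l :=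
  (LinearEquiv.ofInjective (pairFunctional m hpq) (pairFunctional_injective m hpq)).trans
    (LinearEquiv.ofEq _ (carried (limitSet Γ)) (by rw [range_pairFunctional, hΛ]))

lemma toFunctional_moduleEquiv (Γ : Subgroup SL(2, ℝ)) (l : ℂ) (m : ℕ) (hpq : p ≠ q)
    (hΛ : limitSet Γ = {p, q}) (x : rapid × rapid) :
    toFunctional Γ l (moduleEquiv Γ l m hpq hΛ x) = pairFunctional m hpq x := rfl

lemma toFunctional_injective (Γ : Subgroup SL(2, ℝ)) (l : ℂ) :
    Function.Injective (toFunctional Γ l) := Subtype.val_injective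

end HyperfunctionModule

end FuchsianHyperfunction

end

open FuchsianHyperfunction
theorem corollary5p4 (Γ : Subgroup SL(2, ℝ)) (hdisc : DiscreteTopology Γ)
    (hfree : ActsFreely Γ) (hcc : ConvexCocompact Γ) (hnontrivial : Γ ≠ ⊥)
    (habelian : ∀ a ∈ Γ, ∀ b ∈ Γ, a * b = b * a) (k : ℕ) (hk : Odd k) :
    (limitSet Γ).ncard = 2 ∧
    Module.finrank ℂ (groupCohomology (hyperfunctionModule Γ (-(k : ℂ) / 2)) 0) = 2 ∧
    Module.finrank ℂ (groupCohomology (hyperfunctionModule Γ (-(k : ℂ) / 2)) 1) = 2 ∧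
    (∀ c : groupCohomology (hyperfunctionModule Γ (-(k : ℂ) / 2)) 0,
      toFunctional Γ (-(k : ℂ) / 2)
        ((groupCohomology.H0Iso (hyperfunctionModule Γ (-(k : ℂ) / 2))).hom c).1 ∈
          deltaSpan (limitSet Γ)) ∧
    (∀ c : groupCohomology (hyperfunctionModule Γ (-(k : ℂ) / 2)) 1,
      ∃ z : groupCohomology.cocycles₁ (hyperfunctionModule Γ (-(k : ℂ) / 2)),
        groupCohomology.H1π (hyperfunctionModule Γ (-(k : ℂ) / 2)) z = c ∧
        ∀ γ : Γ, toFunctional Γ (-(k : ℂ) / 2) (z γ) ∈ deltaSpan (limitSet Γ)) := by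
  obtain ⟨p, q, hpq, hΛ, hp, hq, γ₀, hγ₀, hgen, hden⟩ :=
    exists_axis hfree hcc hnontrivial habelian
  obtain ⟨m, rfl⟩ := hk
  -- The hyperfunctions are functionals on sections of `T ^ m`, where `k = 2 m + 1`.
  have hm : -(-((2 * m + 1 : ℕ) : ℂ) / 2) - 1 / 2 = (m : ℂ) := by
    push_cast
    ring
  have hdenp : ‖den γ₀ p‖ ≠ 1 := by
    intro h
    have h1 := congrArg norm (den_mul_den hpq (hp _ hγ₀) (hq _ hγ₀))
    rw [norm_mul, h, one_mul, norm_one] at h1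
    exact hden h1
  have hdelta : ∀ α β : ℂ, toFunctional Γ (-((2 * m + 1 : ℕ) : ℂ) / 2)
      (moduleEquiv Γ (-((2 * m + 1 : ℕ) : ℂ) / 2) m hpq hΛ (α • unitSeq m, β • unitSeq m)) ∈
      deltaSpan (limitSet Γ) := by
    intro α β
    rw [toFunctional_moduleEquiv, pairFunctional_apply, map_smul, map_smul]
    exact add_mem
      (Submodule.smul_mem _ _ (germFunctional_unitSeq_mem_deltaSpan m hpq m (by simp [hΛ])))
      (Submodule.smul_mem _ _ (germFunctional_unitSeq_mem_deltaSpan m hpq.symm m (by simp [hΛ])))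
  obtain ⟨d0, d1, r0, r1⟩ := cohomology_of_diagonal
    (hyperfunctionModule Γ (-((2 * m + 1 : ℕ) : ℂ) / 2)) m (moduleEquiv Γ _ m hpq hΛ)
    (fun γ => den γ.1 q ^ 2) (fun γ => den γ.1 p ^ 2)
    (fun γ => pow_ne_zero 2 (den_ne_zero _ (Circle.norm_coe q).le))
    (fun γ => pow_ne_zero 2 (den_ne_zero _ (Circle.norm_coe p).le))
    (fun γ c d => toFunctional_injective _ _ (by
      rw [toFunctional_ρ, toFunctional_moduleEquiv, toFunctional_moduleEquiv, hm,
        pairFunctional_apply, pairFunctional_apply, map_add,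
        dual_germFunctional m hpq (hp _ γ.2) (hq _ γ.2),
        dual_germFunctional m hpq.symm (hq _ γ.2) (hp _ γ.2)]))
    (γ₀ := ⟨γ₀, hγ₀⟩) (fun γ => by
      obtain ⟨n, hn⟩ := hgen γ.1 γ.2
      exact ⟨n, Subtype.ext hn⟩)
    (by
      rw [norm_pow]
      exact fun h => hden ((pow_eq_one_iff_of_nonneg (norm_nonneg _) two_ne_zero).1 h))
    (by
      rw [norm_pow]
      exact fun h => hdenp ((pow_eq_one_iff_of_nonneg (norm_nonneg _) two_ne_zero).1 h))
    (fun γ => (logDen q γ.1 : ℂ))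
    (fun g h => by
      rw [← Complex.ofReal_add]
      exact congrArg _ (logDen_mul g.1 (hq _ h.2)))
    (by
      have h0 := norm_pos_iff.2 (den_ne_zero γ₀ (Circle.norm_coe q).le)
      exact Complex.ofReal_ne_zero.2 (Real.log_ne_zero_of_pos_of_ne_one h0 hden))
  refine ⟨?_, d0, d1, fun c => ?_, fun c => ?_⟩
  · rw [hΛ, Set.ncard_pair hpq]
  · obtain ⟨α, β, h⟩ := r0 c
    rw [h]
    exact hdelta α β
  · obtain ⟨z, hz, h⟩ := r1 c
    refine ⟨z, hz, fun γ => ?_⟩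
    obtain ⟨α, β, h⟩ := h γ
    rw [h]
    exact hdelta α β
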